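/- Write $e(t)=e^{2\pi i t}$. Let $a\in(0,1]$, $C\in\mathbb R$, $c\in(1,2)$ and $0<\eta<\frac{2-(a+1)c}{3-a}$ be real numbers. Then there is a constant $C_1=C_1(a,c,C,\eta)$ with the following property. Let $\varphi$ be any complex-valued arithmetic function (defined on the nonnegative integers) with $|\varphi(n)|\le 1$ for all $n$, and suppose that \[ \int_0^1\ \sup_{x\ge 0}\ \Bigl|\sum_{x<m\le x+z}\varphi(m)\,e(m\theta)\Bigr|\,d\theta\ \le\ C z^{a}\qquad\text{for all real } z\ge 1, \] where $x$ runs through the nonnegative real numbers and $m$ through integers. Then \[ \frac1N\Bigl|\sum_{1\le n\le N}\varphi(\lfloor n^c\rfloor)-\frac1c\sum_{1\le m\le N^c}\varphi(m)\,m^{\frac1c-1}\Bigr|\ \le\ C_1 N^{-\eta}\qquad\text{for all real } N\ge 1 . \] -/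

import Mathlib

open scoped NNReal

noncomputable section

/-- The additive character `e(t) = exp (2 π i t)`. -/
def expTwoPiI (t : ℝ) : ℂ := Complex.exp (2 * (Real.pi : ℂ) * Complex.I * (t : ℂ))

/-- The short exponential sum `∑_{x < m ≤ x + z} φ(m) e(m θ)` for real `x ≥ 0`
(for `x, x + z ≥ 0` the natural numbers `m` with `x < m ≤ x + z` are those with
`⌊x⌋ < m ≤ ⌊x + z⌋`). -/
def shortExpSum (φ : ℕ → ℂ) (z θ : ℝ) (x : ℝ≥0) : ℂ :=
  ∑ m ∈ Finset.Ioc ⌊(x : ℝ)⌋₊ ⌊(x : ℝ) + z⌋₊, φ m * expTwoPiI ((m : ℝ) * θ)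

end

/-!
Put `γ = 1 / c`. The number of `n` with `⌊n ^ c⌋ = m` is `⌈(m + 1) ^ γ⌉ - ⌈m ^ γ⌉`, so the sum over
`n` is, up to `O(1)`, the sum of `φ m` weighted by this number (`sum_Ico_natFloor_rpow_eq`). Replacing
`(m + 1) ^ γ - m ^ γ` by `γ m ^ (γ - 1)` costs `O(1)` by monotonicity, and what has to be estimated
is the sum of `φ m (s((m + 1) ^ γ) - s(m ^ γ))`, where `s(x) = ⌈x⌉ - x - 1 / 2` is the sawtooth
function. It is treated on dyadic blocks `M < m ≤ 2 M + 1`.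

The function `s` is replaced by its Fourier polynomial of degree `H`; the error is at most a constant
times `1 / H` times a sum of normalized Fejér kernels (`abs_sawtooth_sub_sawtoothSum_le`), so that it
too is controlled by exponential sums, this time with the constant function `1` in place of `φ`.

All exponential sums with phase `h m ^ γ` are bounded by `norm_sum_Ioc_rpow_phase_le`. The sum is
averaged over its subsums of length `Z`. On a subsum the phase is replaced by its tangent at a real
point `x`, with slope `θ = h γ x ^ (γ - 1)`, and partial summation bounds the subsum by the suprema in
the hypothesis, at `θ` (`norm_sum_block_le`). Integrating over `x` and substituting `θ` for `x` turns
the average of these suprema over `x` into their average over `θ`, because `θ` moves through about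
`|h| M ^ (γ - 1) + 1` periods (`setIntegral_slope_le`); this is where the hypothesis on `φ` enters.
For the constant function `1` the geometric sum gives the same hypothesis
(`integral_supShortExpSum_one_le`). For `h < M ^ (1 - γ)` the difference of the two phases supplies a
factor `h M ^ (γ - 1)`, so that every frequency `h` contributes `O(M Z ^ (a - 1) / h)`, apart from
smaller terms.

With `H ≈ M ^ (1 - γ + γ η')` and `Z ≈ M ^ ((1 - γ η') / 2)` every error is
`O(M ^ (γ (1 - η')) log² M)` when `η' (3 - a) ≤ 2 - (a + 1) c`, and a choice of `η'` between
`η` and this bound absorbs the logarithms.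
-/

/-! ### The additive character -/

lemma expTwoPiI_eq (t : ℝ) : expTwoPiI t = Complex.exp (((2 * Real.pi * t : ℝ) : ℂ) * Complex.I) := by
  unfold expTwoPiI
  congr 1
  push_cast
  ring

lemma norm_expTwoPiI (t : ℝ) : ‖expTwoPiI t‖ = 1 := by
  rw [expTwoPiI_eq, Complex.norm_exp_ofReal_mul_I]

lemma expTwoPiI_zero : expTwoPiI 0 = 1 := by simp [expTwoPiI]

lemma expTwoPiI_add (s t : ℝ) : expTwoPiI (s + t) = expTwoPiI s * expTwoPiI t := by
  simp only [expTwoPiI, ← Complex.exp_add]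
  congr 1
  push_cast
  ring

lemma expTwoPiI_intCast (n : ℤ) : expTwoPiI n = 1 := by
  rw [← Complex.exp_int_mul_two_pi_mul_I n, expTwoPiI]
  congr 1
  push_cast
  ring

lemma expTwoPiI_add_intCast (t : ℝ) (n : ℤ) : expTwoPiI (t + n) = expTwoPiI t := by
  rw [expTwoPiI_add, expTwoPiI_intCast, mul_one]

lemma continuous_expTwoPiI : Continuous expTwoPiI := by
  unfold expTwoPiI
  fun_prop

lemma norm_expTwoPiI_sub_le (s t : ℝ) :
    ‖expTwoPiI s - expTwoPiI t‖ ≤ 2 * Real.pi * |s - t| := by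
  have h : expTwoPiI s - expTwoPiI t
      = expTwoPiI t * (Complex.exp (Complex.I * ((2 * Real.pi * (s - t) : ℝ) : ℂ)) - 1) := by
    have h1 : s = t + (s - t) := by ring
    conv_lhs => rw [h1, expTwoPiI_add]
    rw [expTwoPiI_eq (s - t), mul_comm Complex.I]
    ring
  rw [h, norm_mul, norm_expTwoPiI, one_mul]
  refine (Real.norm_exp_I_mul_ofReal_sub_one_le).trans ?_
  rw [Real.norm_eq_abs, abs_mul, abs_of_pos Real.two_pi_pos]

lemma sin_two_pi_mul_eq (t : ℝ) :
    ((Real.sin (2 * Real.pi * t) : ℝ) : ℂ)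
      = (expTwoPiI t - expTwoPiI (-t)) / (2 * Complex.I) := by
  rw [expTwoPiI_eq, expTwoPiI_eq, Complex.ofReal_sin, Complex.sin]
  push_cast
  rw [show -(2 * (Real.pi : ℂ) * t) * Complex.I = 2 * Real.pi * (-t) * Complex.I by ring]
  field_simp
  rw [Complex.I_sq]
  ring

/-! ### Suprema of short exponential sums -/

/-- The supremum over the starting point `x ≥ 0` of the short exponential sums of length `z`. -/
noncomputable def supShortExpSum (f : ℕ → ℂ) (z θ : ℝ) : ℝ :=
  ⨆ x : ℝ≥0, ‖shortExpSum f z θ x‖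

lemma norm_shortExpSum_natCast_le {f : ℕ → ℂ} (hf : ∀ n, ‖f n‖ ≤ 1)
    (j : ℕ) (θ : ℝ) (x : ℝ≥0) : ‖shortExpSum f j θ x‖ ≤ j := by
  unfold shortExpSum
  refine (norm_sum_le_of_le (f := fun m : ℕ => f m * expTwoPiI ((m : ℝ) * θ)) (n := fun _ => (1 : ℝ)) _
    fun m _ => ?_).trans ?_
  · rw [norm_mul, norm_expTwoPiI, mul_one]
    exact hf m
  · rw [Nat.floor_add_natCast x.coe_nonneg]
    simp

lemma bddAbove_norm_shortExpSum {f : ℕ → ℂ} (hf : ∀ n, ‖f n‖ ≤ 1)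
    (j : ℕ) (θ : ℝ) :
    BddAbove (Set.range fun x : ℝ≥0 => ‖shortExpSum f j θ x‖) :=
  ⟨j, by rintro _ ⟨x, rfl⟩; exact norm_shortExpSum_natCast_le hf j θ x⟩

lemma supShortExpSum_le {f : ℕ → ℂ} (hf : ∀ n, ‖f n‖ ≤ 1)
    (j : ℕ) (θ : ℝ) : supShortExpSum f j θ ≤ j :=
  ciSup_le fun x => norm_shortExpSum_natCast_le hf j θ x

lemma norm_sum_Ioc_le_supShortExpSum {f : ℕ → ℂ} (hf : ∀ n, ‖f n‖ ≤ 1)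
    (k j : ℕ) (θ : ℝ) :
    ‖∑ m ∈ Finset.Ioc k (k + j), f m * expTwoPiI ((m : ℝ) * θ)‖ ≤ supShortExpSum f j θ := by
  have h := le_ciSup (bddAbove_norm_shortExpSum hf j θ) (k : ℝ≥0)
  refine le_trans (le_of_eq ?_) h
  simp only [shortExpSum, NNReal.coe_natCast, Nat.floor_natCast]
  rw [show ((k : ℝ) + (j : ℝ)) = ((k + j : ℕ) : ℝ) by push_cast; ring, Nat.floor_natCast]

lemma measurable_supShortExpSum {f : ℕ → ℂ} (hf : ∀ n, ‖f n‖ ≤ 1)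
    (j : ℕ) : Measurable (supShortExpSum f j) := by
  have : LowerSemicontinuous (supShortExpSum f j) := by
    refine lowerSemicontinuous_ciSup (fun θ => bddAbove_norm_shortExpSum hf j θ) fun x => ?_
    refine Continuous.lowerSemicontinuous ?_
    unfold shortExpSum
    have := continuous_expTwoPiI
    fun_prop
  exact this.measurable

lemma supShortExpSum_nonneg (f : ℕ → ℂ) (z θ : ℝ) : 0 ≤ supShortExpSum f z θ :=
  Real.iSup_nonneg fun _ => norm_nonneg _

lemma supShortExpSum_zero (f : ℕ → ℂ) (θ : ℝ) : supShortExpSum f 0 θ = 0 := by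
  simp [supShortExpSum, shortExpSum]

lemma periodic_supShortExpSum (f : ℕ → ℂ) (z : ℝ) :
    Function.Periodic (supShortExpSum f z) 1 := by
  intro θ
  unfold supShortExpSum shortExpSum
  congr 1
  ext x
  congr 1
  refine Finset.sum_congr rfl fun m _ => ?_
  rw [mul_add, mul_one]
  rw [show ((m : ℝ)) = ((m : ℤ) : ℝ) by simp, expTwoPiI_add_intCast]

/-! ### Partial summation -/

/-- Abel summation; the term `j = 0` on the right vanishes, its partial sum being empty. -/
lemma sum_Ioc_mul_eq_sub_sum_range (u G : ℕ → ℂ) (k Z : ℕ) :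
    ∑ m ∈ Finset.Ioc k (k + Z), u m * G m
      = (∑ m ∈ Finset.Ioc k (k + Z), u m) * G (k + Z)
        - ∑ j ∈ Finset.range Z, (∑ m ∈ Finset.Ioc k (k + j), u m) * (G (k + j + 1) - G (k + j)) := by
  induction Z with
  | zero => simp
  | succ Z ih =>
    rw [← add_assoc, Finset.sum_Ioc_succ_top (by omega), Finset.sum_Ioc_succ_top (by omega), ih,
      Finset.sum_range_succ]
    ring

lemma norm_sum_Ioc_mul_le (u G : ℕ → ℂ) (k Z : ℕ) {A B : ℝ} (hA : ‖G (k + Z)‖ ≤ A)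
    (hB : ∀ j, 1 ≤ j → j < Z → ‖G (k + j + 1) - G (k + j)‖ ≤ B) :
    ‖∑ m ∈ Finset.Ioc k (k + Z), u m * G m‖
      ≤ A * ‖∑ m ∈ Finset.Ioc k (k + Z), u m‖
        + B * ∑ j ∈ Finset.range Z, ‖∑ m ∈ Finset.Ioc k (k + j), u m‖ := by
  rw [sum_Ioc_mul_eq_sub_sum_range]
  refine (norm_sub_le _ _).trans (add_le_add ?_ ?_)
  · rw [norm_mul, mul_comm]
    gcongr
  · rw [Finset.mul_sum]
    refine norm_sum_le_of_le _ fun j hj => ?_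
    rcases Nat.eq_zero_or_pos j with rfl | h0
    · simp
    · rw [norm_mul, mul_comm]
      exact mul_le_mul_of_nonneg_right (hB j h0 (Finset.mem_range.1 hj)) (norm_nonneg _)

/-! ### The derivative of a power -/

lemma exists_add_one_rpow_sub_rpow_eq {γ y : ℝ} (hy : 0 < y) :
    ∃ ξ ∈ Set.Ioo y (y + 1), (y + 1) ^ γ - y ^ γ = γ * ξ ^ (γ - 1) := by
  obtain ⟨ξ, hξ, h⟩ := exists_hasDerivAt_eq_slope (fun x : ℝ => x ^ γ)
    (fun x => γ * x ^ (γ - 1)) (show y < y + 1 by linarith)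
    (fun x hx => (Real.continuousAt_rpow_const x γ
      (Or.inl (by linarith [hx.1]))).continuousWithinAt)
    (fun x hx => Real.hasDerivAt_rpow_const (Or.inl (by linarith [hx.1])))
  refine ⟨ξ, hξ, ?_⟩
  rw [h]
  simp

lemma hasDerivAt_mul_rpow_sub_one {γ x : ℝ} (hx : 0 < x) (h : ℝ) :
    HasDerivAt (fun x : ℝ => h * γ * x ^ (γ - 1)) (h * γ * ((γ - 1) * x ^ (γ - 2))) x := by
  have := (Real.hasDerivAt_rpow_const (p := γ - 1) (Or.inl hx.ne')).const_mul (h * γ)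
  rwa [show γ - 1 - 1 = γ - 2 by ring] at this

lemma abs_mul_rpow_sub_mul_rpow_le {γ M x y : ℝ} (hγ : γ ∈ Set.Ioo (0 : ℝ) 1) (hM : 0 < M)
    (hx : M ≤ x) (hy : M ≤ y) :
    |γ * x ^ (γ - 1) - γ * y ^ (γ - 1)| ≤ M ^ (γ - 2) * |x - y| := by
  have key := (convex_Ici M).norm_image_sub_le_of_norm_hasDerivWithin_le
    (f := fun x : ℝ => 1 * γ * x ^ (γ - 1)) (C := M ^ (γ - 2))
    (fun x hx => (hasDerivAt_mul_rpow_sub_one (γ := γ) (hM.trans_le hx) 1).hasDerivWithinAt)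
    (fun t ht => ?_) hy hx
  · simpa [Real.norm_eq_abs] using key
  · have ht0 : 0 < t := hM.trans_le ht
    have h1 : t ^ (γ - 2) ≤ M ^ (γ - 2) :=
      Real.rpow_le_rpow_of_nonpos hM ht (by linarith [hγ.2])
    have h2 : 0 ≤ t ^ (γ - 2) := Real.rpow_nonneg ht0.le _
    rw [Real.norm_eq_abs, abs_mul, abs_mul, abs_mul, abs_of_nonneg h2, abs_one,
      abs_of_neg (by linarith [hγ.2] : γ - 1 < 0),
      one_mul, abs_of_pos hγ.1]
    have h3 : γ * (-(γ - 1)) ≤ 1 := by nlinarith [hγ.1, hγ.2]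
    calc γ * (-(γ - 1) * t ^ (γ - 2)) = (γ * (-(γ - 1))) * t ^ (γ - 2) := by ring
      _ ≤ 1 * t ^ (γ - 2) := by gcongr
      _ ≤ _ := by rw [one_mul]; exact h1

lemma abs_add_one_rpow_sub_rpow_le {γ M y : ℝ} (hγ : γ ∈ Set.Ioo (0 : ℝ) 1) (hM : 0 < M)
    (hy : M ≤ y) : |(y + 1) ^ γ - y ^ γ| ≤ M ^ (γ - 1) := by
  obtain ⟨ξ, hξ, h⟩ := exists_add_one_rpow_sub_rpow_eq (γ := γ) (hM.trans_le hy)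
  have hξM : M ≤ ξ := hy.trans hξ.1.le
  rw [h, abs_of_nonneg (mul_nonneg hγ.1.le (Real.rpow_nonneg (hM.le.trans hξM) _))]
  have h1 : ξ ^ (γ - 1) ≤ M ^ (γ - 1) :=
    Real.rpow_le_rpow_of_nonpos hM hξM (by linarith [hγ.2])
  calc γ * ξ ^ (γ - 1) ≤ 1 * ξ ^ (γ - 1) := by
        gcongr
        · exact Real.rpow_nonneg (hM.le.trans hξM) _
        · exact hγ.2.le
    _ ≤ _ := by rw [one_mul]; exact h1

/-! ### Averaging a periodic function along the slopes of a power -/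

section Periodic

open MeasureTheory

lemma intervalIntegral_neg_nat_nat_of_periodic {T : ℝ → ℝ} (hT : Function.Periodic T 1)
    (hint : ∀ u v, IntervalIntegrable T volume u v) (J : ℕ) :
    ∫ θ in (-(J : ℝ))..J, T θ = 2 * J * ∫ θ in (0 : ℝ)..1, T θ := by
  have h1 := hT.intervalIntegral_add_zsmul_eq (2 * J : ℕ) (-(J : ℝ)) hint
  have h2 := hT.intervalIntegral_add_eq (-(J : ℝ)) 0
  rw [zero_add] at h2
  rw [h2] at h1
  have h3 : -(J : ℝ) + (((2 * J : ℕ) : ℤ) • (1 : ℝ)) = J := by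
    simp only [zsmul_eq_mul]
    push_cast
    ring
  rw [h3] at h1
  rw [h1, zsmul_eq_mul]
  push_cast
  ring

/-- The substitution `θ = h γ x ^ (γ - 1)` turns an average over `x` into an average over `θ`,
which is spread over at most `2 (|h| M ^ (γ - 1) + 1)` periods. -/
lemma setIntegral_slope_le {T : ℝ → ℝ} {Bd γ h : ℝ} {M M' : ℕ} (hTm : Measurable T)
    (hT0 : ∀ θ, 0 ≤ T θ) (hTB : ∀ θ, T θ ≤ Bd) (hT : Function.Periodic T 1)
    (hγ : γ ∈ Set.Ioo (0 : ℝ) 1) (hh : h ≠ 0) (hM : 1 ≤ M) (hM' : M' ≤ 4 * M) :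
    ∫ x in Set.Ioc (M : ℝ) M', T (h * γ * x ^ (γ - 1))
      ≤ 32 / (γ * (1 - γ)) * ((M : ℝ) ^ (2 - γ) / |h|) * (|h| * (M : ℝ) ^ (γ - 1) + 1)
        * ∫ θ in (0 : ℝ)..1, T θ := by
  obtain ⟨hγ0, hγ1⟩ := hγ
  have hM0 : (0 : ℝ) < M := by exact_mod_cast hM
  have hh0 : 0 < |h| := abs_pos.2 hh
  set s : Set ℝ := Set.Ioc (M : ℝ) M' with hs
  have hpos : ∀ x ∈ s, 0 < x := fun x hx => hM0.trans hx.1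
  have hTn : ∀ θ, ‖T θ‖ ≤ Bd := fun θ => by rw [Real.norm_eq_abs, abs_of_nonneg (hT0 θ)]; exact hTB θ
  have hint : ∀ u v, IntervalIntegrable T volume u v := fun u v =>
    ⟨Measure.integrableOn_of_bounded (by simp) hTm.aestronglyMeasurable
      (Filter.Eventually.of_forall hTn),
     Measure.integrableOn_of_bounded (by simp) hTm.aestronglyMeasurable
      (Filter.Eventually.of_forall hTn)⟩
  set g : ℝ → ℝ := fun x => h * γ * x ^ (γ - 1) with hg
  set g' : ℝ → ℝ := fun x => h * γ * ((γ - 1) * x ^ (γ - 2)) with hg'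
  have hder : ∀ x ∈ s, HasDerivWithinAt g (g' x) s x := fun x hx =>
    (hasDerivAt_mul_rpow_sub_one (hpos x hx) h).hasDerivWithinAt
  have hinj : Set.InjOn g s := by
    intro x hx y hy hxy
    have h1 : x ^ (γ - 1) = y ^ (γ - 1) := mul_left_cancel₀ (mul_ne_zero hh hγ0.ne') hxy
    exact (Real.rpow_left_injOn (by linarith : γ - 1 ≠ 0)) (hpos x hx).le (hpos y hy).le h1
  have hsub := integral_image_eq_integral_abs_deriv_smul (measurableSet_Ioc) hder hinj T
  -- `1 / κ` is a lower bound for `|g'|`, the range being within `(M, 4 M]`.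
  set κ : ℝ := 16 / (γ * (1 - γ)) * ((M : ℝ) ^ (2 - γ) / |h|) with hκ
  have hκ0 : 0 ≤ κ := by
    have : 0 < γ * (1 - γ) := mul_pos hγ0 (by linarith)
    positivity
  have habs : ∀ x ∈ s, |g' x| = |h| * (γ * (1 - γ)) * x ^ (γ - 2) := fun x hx => by
    rw [hg', abs_mul, abs_mul, abs_mul, abs_of_pos hγ0, abs_of_neg (by linarith : γ - 1 < 0),
      abs_of_nonneg (Real.rpow_nonneg (hpos x hx).le _)]
    ring
  have hlow : ∀ x ∈ s, 1 ≤ κ * |g' x| := fun x hx => by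
    rw [habs x hx, hκ]
    have hne : γ * (1 - γ) ≠ 0 := (mul_pos hγ0 (by linarith)).ne'
    have h1 : 16 / (γ * (1 - γ)) * ((M : ℝ) ^ (2 - γ) / |h|) * (|h| * (γ * (1 - γ)) * x ^ (γ - 2))
        = 16 * ((M : ℝ) ^ (2 - γ) * x ^ (γ - 2)) := by
      have : |h| ≠ 0 := hh0.ne'
      field_simp
    rw [h1]
    have hx4 : x ≤ 4 * M := hx.2.trans (by exact_mod_cast hM')
    have h2 : (4 * (M : ℝ)) ^ (γ - 2) ≤ x ^ (γ - 2) :=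
      Real.rpow_le_rpow_of_nonpos (hpos x hx) hx4 (by linarith)
    have h3 : (4 * (M : ℝ)) ^ (γ - 2) = 4 ^ (γ - 2) * (M : ℝ) ^ (γ - 2) :=
      Real.mul_rpow (by norm_num) hM0.le
    have h4 : (1 / 16 : ℝ) ≤ 4 ^ (γ - 2) := by
      have : (4 : ℝ) ^ (-2 : ℝ) ≤ 4 ^ (γ - 2) :=
        Real.rpow_le_rpow_of_exponent_le (by norm_num) (by linarith)
      refine le_trans (le_of_eq ?_) this
      rw [Real.rpow_neg (by norm_num)]
      norm_num
    have h5 : (M : ℝ) ^ (2 - γ) * (M : ℝ) ^ (γ - 2) = 1 := by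
      rw [← Real.rpow_add hM0]
      simp
    have h6 : 0 < (M : ℝ) ^ (2 - γ) := Real.rpow_pos_of_pos hM0 _
    have h7 : 0 < (M : ℝ) ^ (γ - 2) := Real.rpow_pos_of_pos hM0 _
    calc (1 : ℝ) = 16 * ((M : ℝ) ^ (2 - γ) * ((1 / 16) * (M : ℝ) ^ (γ - 2))) := by
          linear_combination -h5
      _ ≤ 16 * ((M : ℝ) ^ (2 - γ) * (4 ^ (γ - 2) * (M : ℝ) ^ (γ - 2))) := by gcongr
      _ ≤ _ := by rw [← h3]; gcongr
  have hgm : Measurable g := by fun_prop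
  have hg'm : Measurable g' := by fun_prop
  have hI1 : IntegrableOn (fun x => T (g x)) s :=
    Measure.integrableOn_of_bounded (by simp [hs]) (hTm.comp hgm).aestronglyMeasurable
      (Filter.Eventually.of_forall fun x => hTn _)
  set J : ℕ := ⌈|h| * (M : ℝ) ^ (γ - 1)⌉₊ with hJ
  have himage : g '' s ⊆ Set.Icc (-(J : ℝ)) J := by
    rintro _ ⟨x, hx, rfl⟩
    refine abs_le.1 (le_trans ?_ (Nat.le_ceil (|h| * (M : ℝ) ^ (γ - 1))))
    rw [hg, abs_mul, abs_mul, abs_of_pos hγ0, abs_of_nonneg (Real.rpow_nonneg (hpos x hx).le _)]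
    have h1 : x ^ (γ - 1) ≤ (M : ℝ) ^ (γ - 1) :=
      Real.rpow_le_rpow_of_nonpos hM0 hx.1.le (by linarith)
    calc |h| * γ * x ^ (γ - 1) ≤ |h| * 1 * (M : ℝ) ^ (γ - 1) := by
          have := Real.rpow_nonneg (hpos x hx).le (γ - 1)
          gcongr
      _ = _ := by ring
  have himageInt : IntegrableOn T (g '' s) :=
    Measure.integrableOn_of_bounded
      (ne_top_of_le_ne_top (by simp) (measure_mono himage)) hTm.aestronglyMeasurable
      (Filter.Eventually.of_forall hTn)
  have hI2 : IntegrableOn (fun x => κ * (|g' x| * T (g x))) s :=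
    (((integrableOn_image_iff_integrableOn_abs_deriv_smul measurableSet_Ioc hder hinj T).1
      himageInt)).const_mul κ
  calc ∫ x in s, T (g x) ≤ ∫ x in s, κ * (|g' x| * T (g x)) := by
        refine setIntegral_mono_on hI1 hI2 measurableSet_Ioc fun x hx => ?_
        rw [← mul_assoc]
        exact le_mul_of_one_le_left (hT0 _) (hlow x hx)
    _ = κ * ∫ θ in g '' s, T θ := by
        rw [hsub, ← integral_const_mul]
        rfl
    _ ≤ κ * ∫ θ in Set.Icc (-(J : ℝ)) J, T θ := by
        refine mul_le_mul_of_nonneg_left ?_ hκ0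
        exact setIntegral_mono_set
          (Measure.integrableOn_of_bounded (by simp) hTm.aestronglyMeasurable
            (Filter.Eventually.of_forall hTn))
          (Filter.Eventually.of_forall hT0) himage.eventuallyLE
    _ = κ * (2 * J * ∫ θ in (0 : ℝ)..1, T θ) := by
        rw [integral_Icc_eq_integral_Ioc, ← intervalIntegral.integral_of_le
          (by linarith [(Nat.cast_nonneg J : (0 : ℝ) ≤ J)]),
          intervalIntegral_neg_nat_nat_of_periodic hT hint]
    _ ≤ κ * (2 * (|h| * (M : ℝ) ^ (γ - 1) + 1) * ∫ θ in (0 : ℝ)..1, T θ) := by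
        have : (J : ℝ) ≤ |h| * (M : ℝ) ^ (γ - 1) + 1 :=
          (Nat.ceil_lt_add_one (by positivity)).le
        have h0 : 0 ≤ ∫ θ in (0 : ℝ)..1, T θ :=
          intervalIntegral.integral_nonneg (by norm_num) fun θ _ => hT0 θ
        gcongr
    _ = _ := by rw [hκ]; ring

end Periodic

/-! ### Sums with a power phase -/

lemma norm_sum_Ioc_sub_sum_Ico_shift_le (F : ℕ → ℂ) {A : ℝ} {M M' : ℕ} (hMM : M ≤ M')
    (hF : ∀ m, M ≤ m → ‖F m‖ ≤ A) (j : ℕ) :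
    ‖∑ m ∈ Finset.Ioc M M', F m - ∑ k ∈ Finset.Ico M M', F (k + 1 + j)‖ ≤ 2 * A * j := by
  induction j with
  | zero =>
    have : ∑ m ∈ Finset.Ioc M M', F m = ∑ k ∈ Finset.Ico M M', F (k + 1) := by
      rw [Finset.sum_Ico_add' F M M' 1, Finset.Ico_add_one_add_one_eq_Ioc]
    simp [this]
  | succ j ih =>
    have htel : ∑ k ∈ Finset.Ico M M', (F (k + 1 + j + 1) - F (k + 1 + j))
        = F (M' + 1 + j) - F (M + 1 + j) := by
      have := Finset.sum_Ico_sub (fun k => F (k + 1 + j)) hMM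
      rw [← this]
      refine Finset.sum_congr rfl fun k _ => ?_
      rw [show k + 1 + j + 1 = k + 1 + 1 + j by ring]
    have h1 : ∑ m ∈ Finset.Ioc M M', F m - ∑ k ∈ Finset.Ico M M', F (k + 1 + (j + 1))
        = (∑ m ∈ Finset.Ioc M M', F m - ∑ k ∈ Finset.Ico M M', F (k + 1 + j))
          - (F (M' + 1 + j) - F (M + 1 + j)) := by
      rw [← htel, Finset.sum_sub_distrib]
      simp only [← add_assoc]
      ring
    rw [h1]
    refine (norm_sub_le _ _).trans ?_
    have h2 := norm_sub_le (F (M' + 1 + j)) (F (M + 1 + j))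
    have h3 := hF (M' + 1 + j) (by omega)
    have h4 := hF (M + 1 + j) (by omega)
    push_cast
    linarith

/-- Averaging a long sum over all its subsums of length `Z`. -/
lemma mul_norm_sum_Ioc_le (F : ℕ → ℂ) {A : ℝ} {M M' : ℕ} (hMM : M ≤ M')
    (hF : ∀ m, M ≤ m → ‖F m‖ ≤ A) (Z : ℕ) :
    Z * ‖∑ m ∈ Finset.Ioc M M', F m‖
      ≤ ∑ k ∈ Finset.Ico M M', ‖∑ m ∈ Finset.Ioc k (k + Z), F m‖ + 2 * A * (Z : ℝ) ^ 2 := by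
  have hA : 0 ≤ A := (norm_nonneg _).trans (hF M le_rfl)
  have hswap : ∑ k ∈ Finset.Ico M M', ∑ m ∈ Finset.Ioc k (k + Z), F m
      = ∑ j ∈ Finset.range Z, ∑ k ∈ Finset.Ico M M', F (k + 1 + j) := by
    rw [Finset.sum_comm]
    refine Finset.sum_congr rfl fun k _ => ?_
    have : ∑ m ∈ Finset.Ioc k (k + Z), F m = ∑ m ∈ Finset.Ico (k + 1) (k + 1 + Z), F m := by
      rw [add_right_comm, Finset.Ico_add_one_add_one_eq_Ioc]
    rw [this, Finset.sum_Ico_eq_sum_range, Nat.add_sub_cancel_left]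
  have hdiff : ‖(Z : ℂ) * ∑ m ∈ Finset.Ioc M M', F m
      - ∑ k ∈ Finset.Ico M M', ∑ m ∈ Finset.Ioc k (k + Z), F m‖ ≤ 2 * A * (Z : ℝ) ^ 2 := by
    have h1 : (Z : ℂ) * ∑ m ∈ Finset.Ioc M M', F m
        = ∑ _j ∈ Finset.range Z, ∑ m ∈ Finset.Ioc M M', F m := by simp
    rw [hswap, h1, ← Finset.sum_sub_distrib]
    refine (norm_sum_le_of_le (n := fun _ => 2 * A * Z) _ fun j hj => ?_).trans ?_
    · refine (norm_sum_Ioc_sub_sum_Ico_shift_le F hMM hF j).trans ?_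
      have : (j : ℝ) ≤ Z := by exact_mod_cast (Finset.mem_range.1 hj).le
      gcongr
    · simp only [Finset.sum_const, Finset.card_range, nsmul_eq_mul]
      exact le_of_eq (by ring)
  have h2 : (Z : ℝ) * ‖∑ m ∈ Finset.Ioc M M', F m‖ = ‖(Z : ℂ) * ∑ m ∈ Finset.Ioc M M', F m‖ := by
    rw [norm_mul, Complex.norm_natCast]
  rw [h2]
  have h3 := norm_sub_norm_le ((Z : ℂ) * ∑ m ∈ Finset.Ioc M M', F m)
    (∑ k ∈ Finset.Ico M M', ∑ m ∈ Finset.Ioc k (k + Z), F m)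
  have h4 := norm_sum_le (Finset.Ico M M') fun k => ∑ m ∈ Finset.Ioc k (k + Z), F m
  linarith

/-- The bound for a block of length `Z` with phase close to `θ m` that partial summation gives,
`D / Z` being the variation of the remaining weight per step. -/
noncomputable def blockMajorant (f : ℕ → ℂ) (D : ℝ) (Z : ℕ) (θ : ℝ) : ℝ :=
  supShortExpSum f Z θ + D / Z * ∑ j ∈ Finset.range Z, supShortExpSum f j θ

lemma blockMajorant_nonneg (f : ℕ → ℂ) {D : ℝ} (hD : 0 ≤ D) (Z : ℕ) (θ : ℝ) :
    0 ≤ blockMajorant f D Z θ :=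
  add_nonneg (supShortExpSum_nonneg _ _ _)
    (mul_nonneg (by positivity) (Finset.sum_nonneg fun _ _ => supShortExpSum_nonneg _ _ _))

lemma blockMajorant_le {f : ℕ → ℂ} (hf : ∀ n, ‖f n‖ ≤ 1) {D : ℝ} (hD : 0 ≤ D) (Z : ℕ) (θ : ℝ) :
    blockMajorant f D Z θ ≤ Z + D / Z * ∑ j ∈ Finset.range Z, (j : ℝ) := by
  unfold blockMajorant
  gcongr with j _
  · exact supShortExpSum_le hf Z θ
  · exact supShortExpSum_le hf j θ

lemma measurable_blockMajorant {f : ℕ → ℂ} (hf : ∀ n, ‖f n‖ ≤ 1) (D : ℝ) (Z : ℕ) :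
    Measurable (blockMajorant f D Z) :=
  (measurable_supShortExpSum hf Z).add
    ((Finset.measurable_fun_sum _ fun j _ => measurable_supShortExpSum hf j).const_mul _)

lemma periodic_blockMajorant (f : ℕ → ℂ) (D : ℝ) (Z : ℕ) :
    Function.Periodic (blockMajorant f D Z) 1 := fun θ => by
  simp only [blockMajorant, periodic_supShortExpSum f _ θ]

/-- On a block of length `Z` the phase `h m ^ γ` may be replaced by its tangent at any point `x` of
the first unit interval of the block. -/
lemma norm_sum_block_le {f : ℕ → ℂ} (hf : ∀ n, ‖f n‖ ≤ 1) {γ h A b D x : ℝ} {M k Z : ℕ}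
    {W : ℕ → ℂ} (hγ : γ ∈ Set.Ioo (0 : ℝ) 1) (hM : 1 ≤ M) (hk : M ≤ k)
    (hW : ∀ m, M ≤ m → ‖W m‖ ≤ A) (hdW : ∀ m, M ≤ m → ‖W (m + 1) - W m‖ ≤ A * b)
    (hD : 2 * Real.pi * (|h| * (M : ℝ) ^ (γ - 2) * Z) + b ≤ D / Z)
    (hx : x ∈ Set.Ioc (k : ℝ) (k + 1)) :
    ‖∑ m ∈ Finset.Ioc k (k + Z), f m * (expTwoPiI (h * (m : ℝ) ^ γ) * W m)‖
      ≤ A * blockMajorant f D Z (h * γ * x ^ (γ - 1)) := by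
  have hA : 0 ≤ A := (norm_nonneg _).trans (hW M le_rfl)
  have hM0 : (0 : ℝ) < M := by exact_mod_cast hM
  have hkM : (M : ℝ) ≤ k := by exact_mod_cast hk
  set θ := h * γ * x ^ (γ - 1) with hθ
  set G : ℕ → ℂ := fun m => expTwoPiI (h * (m : ℝ) ^ γ - m * θ) * W m with hG
  have hsplit : ∀ m, f m * (expTwoPiI (h * (m : ℝ) ^ γ) * W m)
      = (f m * expTwoPiI ((m : ℝ) * θ)) * G m := fun m => by
    have h1 : h * (m : ℝ) ^ γ = m * θ + (h * (m : ℝ) ^ γ - m * θ) := by ring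
    simp only [hG]
    conv_lhs => rw [h1, expTwoPiI_add]
    ring
  simp only [hsplit]
  have hGA : ‖G (k + Z)‖ ≤ A := by
    simp only [hG]
    rw [norm_mul, norm_expTwoPiI, one_mul]
    exact hW _ (by omega)
  have hGB : ∀ j, 1 ≤ j → j < Z → ‖G (k + j + 1) - G (k + j)‖ ≤ A * (D / Z) := by
    intro j hj1 hjZ
    set m := k + j with hm
    have hmM : M ≤ m := by omega
    have hm0 : (0 : ℝ) < m := by exact_mod_cast (by omega : 0 < m)
    have hmk : (m : ℝ) = k + j := by rw [hm]; push_cast; ring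
    obtain ⟨ξ, hξ, hξe⟩ := exists_add_one_rpow_sub_rpow_eq (γ := γ) hm0
    have hj1' : (1 : ℝ) ≤ j := by exact_mod_cast hj1
    have hjZ' : (j : ℝ) + 1 ≤ Z := by exact_mod_cast hjZ
    have hξx : |ξ - x| ≤ Z := by
      rw [abs_le]
      constructor <;> linarith [hξ.1, hξ.2, hx.1, hx.2]
    have hcurv : |(h * ((m + 1 : ℕ) : ℝ) ^ γ - (m + 1 : ℕ) * θ) - (h * (m : ℝ) ^ γ - m * θ)|
        ≤ |h| * (M : ℝ) ^ (γ - 2) * Z := by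
      have h1 : (h * ((m + 1 : ℕ) : ℝ) ^ γ - (m + 1 : ℕ) * θ) - (h * (m : ℝ) ^ γ - m * θ)
          = h * (γ * ξ ^ (γ - 1) - γ * x ^ (γ - 1)) := by
        rw [← hξe, hθ]
        push_cast
        ring
      rw [h1, abs_mul, mul_assoc]
      refine mul_le_mul_of_nonneg_left ?_ (abs_nonneg h)
      refine (abs_mul_rpow_sub_mul_rpow_le hγ hM0 ?_ ?_).trans ?_
      · linarith [hξ.1]
      · linarith [hx.1]
      · gcongr
    have h2 : G (m + 1) - G m
        = (expTwoPiI (h * ((m + 1 : ℕ) : ℝ) ^ γ - (m + 1 : ℕ) * θ)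
            - expTwoPiI (h * (m : ℝ) ^ γ - m * θ)) * W (m + 1)
          + expTwoPiI (h * (m : ℝ) ^ γ - m * θ) * (W (m + 1) - W m) := by
      simp only [hG]
      ring
    rw [h2]
    refine (norm_add_le _ _).trans ?_
    rw [norm_mul, norm_mul, norm_expTwoPiI, one_mul]
    have h3 := (norm_expTwoPiI_sub_le (h * ((m + 1 : ℕ) : ℝ) ^ γ - (m + 1 : ℕ) * θ)
      (h * (m : ℝ) ^ γ - m * θ)).trans (mul_le_mul_of_nonneg_left hcurv Real.two_pi_pos.le)
    calc _ ≤ (2 * Real.pi * (|h| * (M : ℝ) ^ (γ - 2) * Z)) * A + A * b :=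
          add_le_add (mul_le_mul h3 (hW _ (by omega)) (norm_nonneg _) (by positivity)) (hdW m hmM)
      _ = A * (2 * Real.pi * (|h| * (M : ℝ) ^ (γ - 2) * Z) + b) := by ring
      _ ≤ _ := by gcongr
  refine (norm_sum_Ioc_mul_le (fun m => f m * expTwoPiI ((m : ℝ) * θ)) G k Z hGA hGB).trans ?_
  have hDZ : 0 ≤ A * (D / Z) := by
    rcases Nat.eq_zero_or_pos Z with rfl | hZ
    · simp
    · have hb : 0 ≤ A * b := (norm_nonneg _).trans (hdW M le_rfl)
      have h5 : 0 ≤ A * (2 * Real.pi * (|h| * (M : ℝ) ^ (γ - 2) * Z) + b) := by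
        rw [mul_add]
        positivity
      exact h5.trans (mul_le_mul_of_nonneg_left hD hA)
  rw [blockMajorant, mul_add, ← mul_assoc A (D / Z)]
  refine add_le_add (mul_le_mul_of_nonneg_left (norm_sum_Ioc_le_supShortExpSum hf _ _ _) hA)
    (mul_le_mul_of_nonneg_left
      (Finset.sum_le_sum fun j _ => norm_sum_Ioc_le_supShortExpSum hf _ _ _) hDZ)

/-- The bound for exponential sums with phase `h m ^ γ` and a weight `W` of slow variation, in terms
of the mean over `θ` of the bound for short sums with linear phase `m θ`. The term `2 Z` comes from
the ends of the range of summation. -/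
lemma norm_sum_Ioc_rpow_phase_le {f : ℕ → ℂ} (hf : ∀ n, ‖f n‖ ≤ 1) {γ h A b D : ℝ} {M M' Z : ℕ}
    {W : ℕ → ℂ} (hγ : γ ∈ Set.Ioo (0 : ℝ) 1) (hh : h ≠ 0) (hM : 1 ≤ M) (hMM : M ≤ M')
    (hM' : M' ≤ 4 * M) (hZ : 1 ≤ Z) (hD0 : 0 ≤ D)
    (hW : ∀ m, M ≤ m → ‖W m‖ ≤ A) (hdW : ∀ m, M ≤ m → ‖W (m + 1) - W m‖ ≤ A * b)
    (hD : 2 * Real.pi * (|h| * (M : ℝ) ^ (γ - 2) * Z) + b ≤ D / Z) :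
    ‖∑ m ∈ Finset.Ioc M M', f m * (expTwoPiI (h * (m : ℝ) ^ γ) * W m)‖
      ≤ A * (32 / (γ * (1 - γ)) * ((M : ℝ) ^ (2 - γ) / |h|) * (|h| * (M : ℝ) ^ (γ - 1) + 1)
        * ((∫ θ in (0 : ℝ)..1, blockMajorant f D Z θ) / Z) + 2 * Z) := by
  have hA : 0 ≤ A := (norm_nonneg _).trans (hW M le_rfl)
  have hZ0 : (0 : ℝ) < Z := by exact_mod_cast hZ
  have hmeas := measurable_blockMajorant hf D Z
  have hTB := blockMajorant_le hf hD0 Z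
  set T := blockMajorant f D Z with hT
  set Bd : ℝ := Z + D / Z * ∑ j ∈ Finset.range Z, (j : ℝ) with hBd
  have hT0 : ∀ θ, 0 ≤ T θ := blockMajorant_nonneg f hD0 Z
  have hcomp : Measurable fun x : ℝ => T (h * γ * x ^ (γ - 1)) :=
    hmeas.comp (by fun_prop)
  have hint : ∀ u v : ℝ, MeasureTheory.IntegrableOn (fun x : ℝ => T (h * γ * x ^ (γ - 1)))
      (Set.Ioc u v) := fun u v =>
    MeasureTheory.Measure.integrableOn_of_bounded (by simp) hcomp.aestronglyMeasurable
      (Filter.Eventually.of_forall fun x => by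
        rw [Real.norm_eq_abs, abs_of_nonneg (hT0 _)]; exact hTB _)
  have hblock : ∀ k ∈ Finset.Ico M M',
      ‖∑ m ∈ Finset.Ioc k (k + Z), f m * (expTwoPiI (h * (m : ℝ) ^ γ) * W m)‖
        ≤ ∫ x in (k : ℝ)..((k + 1 : ℕ) : ℝ), A * T (h * γ * x ^ (γ - 1)) := by
    intro k hk
    set S := ‖∑ m ∈ Finset.Ioc k (k + Z), f m * (expTwoPiI (h * (m : ℝ) ^ γ) * W m)‖
    have h1 : S = ∫ _x in Set.Ioc (k : ℝ) ((k + 1 : ℕ) : ℝ), S := by simp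
    rw [intervalIntegral.integral_of_le (by push_cast; linarith), h1]
    refine MeasureTheory.setIntegral_mono_on (by simp) ((hint _ _).const_mul A) measurableSet_Ioc
      fun x hx => ?_
    refine norm_sum_block_le hf hγ hM (Finset.mem_Ico.1 hk).1 hW hdW hD ?_
    push_cast at hx
    exact hx
  have hsum : ∑ k ∈ Finset.Ico M M',
      ‖∑ m ∈ Finset.Ioc k (k + Z), f m * (expTwoPiI (h * (m : ℝ) ^ γ) * W m)‖
        ≤ A * ∫ x in Set.Ioc (M : ℝ) M', T (h * γ * x ^ (γ - 1)) := by
    refine (Finset.sum_le_sum hblock).trans (le_of_eq ?_)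
    rw [intervalIntegral.sum_integral_adjacent_intervals_Ico hMM fun k _ => ?_,
      intervalIntegral.integral_const_mul, intervalIntegral.integral_of_le (by exact_mod_cast hMM)]
    exact ⟨(hint _ _).const_mul A, (hint _ _).const_mul A⟩
  have hslope := setIntegral_slope_le hmeas hT0 hTB (periodic_blockMajorant f D Z) hγ hh hM hM'
  have havg := mul_norm_sum_Ioc_le (fun m => f m * (expTwoPiI (h * (m : ℝ) ^ γ) * W m)) hMM
    (A := A) (fun m hm => by
      rw [norm_mul, norm_mul, norm_expTwoPiI, one_mul]
      exact (mul_le_of_le_one_left (norm_nonneg _) (hf m)).trans (hW m hm)) Z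
  have hfin := havg.trans (add_le_add_left (hsum.trans (mul_le_mul_of_nonneg_left hslope hA)) _)
  refine le_of_mul_le_mul_left (hfin.trans (le_of_eq ?_)) hZ0
  field_simp

/-! ### First moments of the suprema -/

lemma intervalIntegrable_supShortExpSum {f : ℕ → ℂ} (hf : ∀ n, ‖f n‖ ≤ 1) (j : ℕ) (u v : ℝ) :
    IntervalIntegrable (supShortExpSum f j) MeasureTheory.volume u v := by
  have h : ∀ s : Set ℝ, MeasureTheory.volume s ≠ ⊤ →
      MeasureTheory.IntegrableOn (supShortExpSum f j) s := fun s hs =>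
    MeasureTheory.Measure.integrableOn_of_bounded (M := j) hs
      (measurable_supShortExpSum hf j).aestronglyMeasurable
      (Filter.Eventually.of_forall fun θ => by
        rw [Real.norm_eq_abs, abs_of_nonneg (supShortExpSum_nonneg _ _ _)]
        exact supShortExpSum_le hf j θ)
  exact ⟨h _ (by simp), h _ (by simp)⟩

lemma integral_blockMajorant_le {f : ℕ → ℂ} (hf : ∀ n, ‖f n‖ ≤ 1) {a C D : ℝ} (ha : 0 < a)
    (hC : 0 ≤ C) (hD : 0 ≤ D)
    (hI : ∀ j : ℕ, 1 ≤ j → ∫ θ in (0 : ℝ)..1, supShortExpSum f j θ ≤ C * (j : ℝ) ^ a)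
    {Z : ℕ} (hZ : 1 ≤ Z) :
    ∫ θ in (0 : ℝ)..1, blockMajorant f D Z θ ≤ C * (1 + D) * (Z : ℝ) ^ a := by
  have hZ0 : (0 : ℝ) < Z := by exact_mod_cast hZ
  have hint := fun j => intervalIntegrable_supShortExpSum hf j 0 1
  have hsum : IntervalIntegrable
      (fun θ => D / Z * ∑ j ∈ Finset.range Z, supShortExpSum f j θ) MeasureTheory.volume 0 1 := by
    have := (IntervalIntegrable.sum (Finset.range Z) fun j _ => hint j).const_mul (D / Z)
    simpa only [Finset.sum_apply] using this
  unfold blockMajorant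
  rw [intervalIntegral.integral_add (hint Z) hsum,
    intervalIntegral.integral_const_mul, intervalIntegral.integral_finsetSum fun j _ => hint j]
  have h1 : ∀ j ∈ Finset.range Z,
      ∫ θ in (0 : ℝ)..1, supShortExpSum f j θ ≤ C * (Z : ℝ) ^ a := by
    intro j hj
    rcases Nat.eq_zero_or_pos j with rfl | h0
    · simp only [Nat.cast_zero, supShortExpSum_zero, intervalIntegral.integral_zero]
      positivity
    · refine (hI j h0).trans ?_
      have : (j : ℝ) ≤ Z := by exact_mod_cast (Finset.mem_range.1 hj).le
      gcongr
  have h2 := Finset.sum_le_sum h1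
  rw [Finset.sum_const, Finset.card_range, nsmul_eq_mul] at h2
  calc _ ≤ C * (Z : ℝ) ^ a + D / Z * (Z * (C * (Z : ℝ) ^ a)) := by
        gcongr
        exact hI Z hZ
    _ = _ := by
        field_simp

lemma norm_sum_Ioc_expTwoPiI_mul_le (k j : ℕ) (θ : ℝ) :
    ‖∑ m ∈ Finset.Ioc k (k + j), expTwoPiI ((m : ℝ) * θ)‖ * |Real.sin (Real.pi * θ)| ≤ 1 := by
  have htel : (∑ m ∈ Finset.Ioc k (k + j), expTwoPiI ((m : ℝ) * θ)) * (expTwoPiI θ - 1)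
      = expTwoPiI (((k + j + 1 : ℕ) : ℝ) * θ) - expTwoPiI (((k + 1 : ℕ) : ℝ) * θ) := by
    induction j with
    | zero => simp
    | succ j ih =>
      rw [← add_assoc, Finset.sum_Ioc_succ_top (by omega), add_mul, ih, mul_sub, mul_one,
        ← expTwoPiI_add, ← add_one_mul]
      push_cast
      ring
  have hsin : ‖expTwoPiI θ - 1‖ = 2 * |Real.sin (Real.pi * θ)| := by
    rw [expTwoPiI_eq, mul_comm _ Complex.I, Complex.norm_exp_I_mul_ofReal_sub_one, norm_mul,
      Real.norm_eq_abs, Real.norm_eq_abs, abs_two]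
    congr 3
    ring
  have h1 := congrArg norm htel
  rw [norm_mul, hsin] at h1
  have h2 := norm_sub_le (expTwoPiI (((k + j + 1 : ℕ) : ℝ) * θ)) (expTwoPiI (((k + 1 : ℕ) : ℝ) * θ))
  rw [norm_expTwoPiI, norm_expTwoPiI] at h2
  linarith

lemma two_mul_min_le_sin_pi_mul {θ : ℝ} (h0 : 0 ≤ θ) (h1 : θ ≤ 1) :
    2 * min θ (1 - θ) ≤ Real.sin (Real.pi * θ) := by
  have key : ∀ t : ℝ, 0 ≤ t → t ≤ 1 / 2 → 2 * t ≤ Real.sin (Real.pi * t) := fun t ht0 ht1 => by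
    have h := Real.mul_le_sin (x := Real.pi * t) (by positivity) (by nlinarith [Real.pi_pos])
    refine le_trans (le_of_eq ?_) h
    field_simp
  rcases le_total θ (1 / 2) with h | h
  · rw [min_eq_left (by linarith)]
    exact key θ h0 h
  · rw [min_eq_right (by linarith)]
    have := key (1 - θ) (by linarith) (by linarith)
    rwa [mul_sub Real.pi, mul_one, Real.sin_pi_sub] at this

/-- The geometric sum bounds `min (j, 1 / ‖θ‖)` by a product of powers whose integral is
`O(j ^ a)`. -/
lemma supShortExpSum_one_le {a : ℝ} (ha : a ∈ Set.Ioc (0 : ℝ) 1) (j : ℕ) {θ : ℝ}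
    (hθ : θ ∈ Set.Ioo (0 : ℝ) 1) :
    supShortExpSum (fun _ => 1) j θ ≤ (j : ℝ) ^ a * (θ ^ (a - 1) + (1 - θ) ^ (a - 1)) := by
  set t := min θ (1 - θ) with ht
  have ht0 : 0 < t := lt_min hθ.1 (by linarith [hθ.2])
  have hsin := two_mul_min_le_sin_pi_mul hθ.1.le hθ.2.le
  rw [← ht] at hsin
  have h1 : supShortExpSum (fun _ => 1) j θ ≤ t⁻¹ := by
    refine ciSup_le fun x => ?_
    have h := norm_sum_Ioc_expTwoPiI_mul_le ⌊(x : ℝ)⌋₊ j θ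
    rw [abs_of_pos (by linarith)] at h
    simp only [shortExpSum, one_mul]
    rw [Nat.floor_add_natCast x.coe_nonneg, ← one_div, le_div_iff₀ ht0]
    refine le_trans (mul_le_mul_of_nonneg_left ?_ (norm_nonneg _)) h
    linarith
  have h2 : supShortExpSum (fun _ => 1) j θ ≤ j := supShortExpSum_le (by simp) j θ
  set S := supShortExpSum (fun _ => 1) j θ with hS
  have hS0 : 0 ≤ S := supShortExpSum_nonneg _ _ _
  have h3 : t ^ (a - 1) ≤ θ ^ (a - 1) + (1 - θ) ^ (a - 1) := by
    have p1 : 0 ≤ θ ^ (a - 1) := Real.rpow_nonneg hθ.1.le _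
    have p2 : 0 ≤ (1 - θ) ^ (a - 1) := Real.rpow_nonneg (by linarith [hθ.2]) _
    rcases min_choice θ (1 - θ) with h | h <;> rw [ht, h] <;> linarith
  calc S = S ^ a * S ^ (1 - a) := by
        rw [← Real.rpow_add_of_nonneg hS0 ha.1.le (by linarith [ha.2])]
        simp
    _ ≤ (j : ℝ) ^ a * t⁻¹ ^ (1 - a) := by
        have := ha.1
        have := ha.2
        gcongr
    _ = (j : ℝ) ^ a * t ^ (a - 1) := by
        rw [Real.inv_rpow ht0.le, ← Real.rpow_neg ht0.le, neg_sub]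
    _ ≤ _ := by gcongr

lemma integral_supShortExpSum_one_le {a : ℝ} (ha : a ∈ Set.Ioc (0 : ℝ) 1) (j : ℕ) :
    ∫ θ in (0 : ℝ)..1, supShortExpSum (fun _ => 1) j θ ≤ 2 / a * (j : ℝ) ^ a := by
  have h1 : IntervalIntegrable (fun θ : ℝ => θ ^ (a - 1)) MeasureTheory.volume 0 1 :=
    intervalIntegral.intervalIntegrable_rpow' (by linarith [ha.1])
  have h2 : IntervalIntegrable (fun θ : ℝ => (1 - θ) ^ (a - 1)) MeasureTheory.volume 0 1 := by
    simpa using (h1.comp_sub_left 1).symm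
  have hi : ∫ θ in (0 : ℝ)..1, θ ^ (a - 1) = 1 / a := by
    rw [integral_rpow (Or.inl (by linarith [ha.1]))]
    simp [ha.1.ne']
  have hi2 : ∫ θ in (0 : ℝ)..1, (1 - θ) ^ (a - 1) = 1 / a := by
    rw [intervalIntegral.integral_comp_sub_left (fun θ : ℝ => θ ^ (a - 1)) 1]
    simpa using hi
  refine (intervalIntegral.integral_mono_on_of_le_Ioo (by norm_num)
    (intervalIntegrable_supShortExpSum (by simp) j 0 1) ((h1.add h2).const_mul ((j : ℝ) ^ a))
    fun θ hθ => supShortExpSum_one_le ha j hθ).trans (le_of_eq ?_)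
  rw [intervalIntegral.integral_const_mul]
  rw [intervalIntegral.integral_add h1 h2, hi, hi2]
  ring

/-! ### Fourier approximation of the sawtooth function -/

/-- The Fourier polynomial of degree `H` of the sawtooth function `⌈x⌉ - x - 1 / 2`. -/
noncomputable def sawtoothSum (H : ℕ) (x : ℝ) : ℝ :=
  ∑ h ∈ Finset.Icc 1 H, Real.sin (2 * Real.pi * (h * x)) / (Real.pi * h)

lemma sawtoothSum_neg (H : ℕ) (x : ℝ) : sawtoothSum H (-x) = -sawtoothSum H x := by
  simp only [sawtoothSum, mul_neg, Real.sin_neg, neg_div, Finset.sum_neg_distrib]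

lemma sawtoothSum_add_intCast (H : ℕ) (x : ℝ) (n : ℤ) :
    sawtoothSum H (x + n) = sawtoothSum H x := by
  refine Finset.sum_congr rfl fun h _ => ?_
  have : 2 * Real.pi * (h * (x + n)) = 2 * Real.pi * (h * x) + ((h * n : ℤ) : ℝ) * (2 * Real.pi) := by
    push_cast
    ring
  rw [this, Real.sin_add_int_mul_two_pi]

lemma abs_sawtoothSum_le (H : ℕ) (x : ℝ) : |sawtoothSum H x| ≤ 2 * H * |x| := by
  refine (Finset.abs_sum_le_sum_abs _ _).trans ?_
  have : ∀ h ∈ Finset.Icc 1 H, |Real.sin (2 * Real.pi * (h * x)) / (Real.pi * h)| ≤ 2 * |x| := by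
    intro h hh
    have h0 : (0 : ℝ) < h := by exact_mod_cast (Finset.mem_Icc.1 hh).1
    have hp : 0 < Real.pi * h := by positivity
    rw [abs_div, abs_of_pos hp, div_le_iff₀ hp]
    refine Real.abs_sin_le_abs.trans (le_of_eq ?_)
    rw [abs_mul (2 * Real.pi), abs_mul (h : ℝ), abs_of_pos Real.two_pi_pos, abs_of_pos h0]
    ring
  refine (Finset.sum_le_sum this).trans (le_of_eq ?_)
  rw [Finset.sum_const, Nat.card_Icc, nsmul_eq_mul, Nat.add_sub_cancel]
  ring

lemma dirichletKernel_mul_sin (H : ℕ) (x : ℝ) :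
    (1 + 2 * ∑ h ∈ Finset.Icc 1 H, Real.cos (2 * Real.pi * (h * x))) * Real.sin (Real.pi * x)
      = Real.sin ((2 * H + 1) * (Real.pi * x)) := by
  induction H with
  | zero => simp
  | succ H ih =>
    rw [Finset.sum_Icc_succ_top (by omega), mul_add, ← add_assoc, add_mul, ih]
    have h1 : (2 * ((H + 1 : ℕ) : ℝ) + 1) * (Real.pi * x)
        = 2 * Real.pi * ((H + 1 : ℕ) * x) + Real.pi * x := by ring
    have h2 : (2 * (H : ℝ) + 1) * (Real.pi * x)
        = 2 * Real.pi * ((H + 1 : ℕ) * x) - Real.pi * x := by push_cast; ring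
    rw [h1, h2, Real.sin_add, Real.sin_sub]
    ring

lemma hasDerivAt_sawtoothSum (H : ℕ) (x : ℝ) :
    HasDerivAt (sawtoothSum H) (2 * ∑ h ∈ Finset.Icc 1 H, Real.cos (2 * Real.pi * (h * x))) x := by
  rw [Finset.mul_sum]
  unfold sawtoothSum
  refine HasDerivAt.fun_sum fun h hh => ?_
  have h0 : (h : ℝ) ≠ 0 := by
    have := (Finset.mem_Icc.1 hh).1
    positivity
  have h1 : HasDerivAt (fun x : ℝ => 2 * Real.pi * (h * x)) (2 * Real.pi * (h * 1)) x :=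
    ((hasDerivAt_id x).const_mul (h : ℝ)).const_mul (2 * Real.pi)
  refine ((h1.sin).div_const (Real.pi * h)).congr_deriv (Eq.symm ?_)
  rw [eq_div_iff (mul_ne_zero Real.pi_ne_zero h0)]
  ring

/-- The derivative of the error is a Dirichlet kernel; integrating by parts against the monotone
function `1 / sin (π x)` gives the decay of the error away from the integers. -/
lemma abs_sub_sawtoothSum_le (H : ℕ) {x : ℝ} (hx0 : 0 < x) (hx : x ≤ 1 / 2) :
    |1 / 2 - x - sawtoothSum H x| ≤ 1 / ((2 * H + 1) * Real.pi * x) := by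
  set n : ℝ := 2 * H + 1 with hn
  have hn0 : 0 < n := by positivity
  have hπ := Real.pi_pos
  set q : ℝ → ℝ := fun t => (n * Real.pi * Real.sin (Real.pi * t))⁻¹ with hq
  set q' : ℝ → ℝ := fun t =>
    -(n * Real.pi * (Real.cos (Real.pi * t) * Real.pi)) / (n * Real.pi * Real.sin (Real.pi * t)) ^ 2
    with hq'
  -- `Q` is the error minus the boundary term of the integration by parts, so that `|Q'| ≤ -q'` and
  -- `Q (1 / 2) = 0`.
  set Q : ℝ → ℝ := fun t => (1 / 2 - t - sawtoothSum H t) - Real.cos (n * (Real.pi * t)) * q t with hQ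
  have hsin : ∀ t ∈ Set.Icc x (1 / 2), 0 < Real.sin (Real.pi * t) := fun t ht =>
    Real.sin_pos_of_pos_of_lt_pi (mul_pos hπ (hx0.trans_le ht.1)) (by nlinarith [ht.2])
  have hcos : ∀ t ∈ Set.Icc x (1 / 2), 0 ≤ Real.cos (Real.pi * t) := fun t ht =>
    Real.cos_nonneg_of_neg_pi_div_two_le_of_le (by nlinarith [ht.1]) (by nlinarith [ht.2])
  have hlin : ∀ t : ℝ, HasDerivAt (fun t : ℝ => Real.pi * t) Real.pi t := fun t => by
    simpa using (hasDerivAt_id t).const_mul Real.pi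
  have hqd : ∀ t ∈ Set.Icc x (1 / 2), HasDerivAt q (q' t) t := fun t ht =>
    (((hlin t).sin).const_mul (n * Real.pi)).inv
      (by have := hsin t ht; positivity)
  have hQd : ∀ t ∈ Set.Icc x (1 / 2), HasDerivAt Q (-(Real.cos (n * (Real.pi * t)) * q' t)) t := by
    intro t ht
    have hs := hsin t ht
    have h1 := ((((hasDerivAt_id t).const_sub (1 / 2)).sub (hasDerivAt_sawtoothSum H t))).sub
      ((((hlin t).const_mul n).cos).mul (hqd t ht))
    refine h1.congr_deriv ?_
    have hd := dirichletKernel_mul_sin H t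
    rw [← hn] at hd
    have h2 : Real.sin (n * (Real.pi * t)) * (n * Real.pi) * q t
        = 1 + 2 * ∑ h ∈ Finset.Icc 1 H, Real.cos (2 * Real.pi * (h * t)) := by
      have hne : n * Real.pi * Real.sin (Real.pi * t) ≠ 0 := by positivity
      rw [← hd, hq]
      simp only
      rw [← div_eq_mul_inv, div_eq_iff hne]
      ring
    linear_combination h2
  have hq'0 : ∀ t ∈ Set.Icc x (1 / 2), q' t ≤ 0 := fun t ht => by
    have := hcos t ht
    rw [hq']
    refine div_nonpos_of_nonpos_of_nonneg ?_ (sq_nonneg _)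
    have : 0 ≤ n * Real.pi * (Real.cos (Real.pi * t) * Real.pi) := by positivity
    linarith
  have hQhalf : Q (1 / 2) = 0 := by
    have h1 : Real.cos (n * (Real.pi * (1 / 2))) = 0 := by
      rw [Real.cos_eq_zero_iff]
      exact ⟨H, by rw [hn]; push_cast; ring⟩
    have h2 : sawtoothSum H (1 / 2) = 0 := by
      refine Finset.sum_eq_zero fun h _ => ?_
      rw [show 2 * Real.pi * ((h : ℝ) * (1 / 2)) = h * Real.pi by ring, Real.sin_nat_mul_pi, zero_div]
    simp only [hQ, h1, h2]
    norm_num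
  have hq0 : ∀ t ∈ Set.Icc x (1 / 2), 0 < q t := fun t ht => by
    have := hsin t ht
    simp only [hq]
    positivity
  have hmono : ∀ ε : ℝ, |ε| ≤ 1 → 0 ≤ q x + ε * Q x := by
    intro ε hε
    have hanti : AntitoneOn (fun t => q t + ε * Q t) (Set.Icc x (1 / 2)) := by
      have hd : ∀ t ∈ Set.Icc x (1 / 2), HasDerivAt (fun t => q t + ε * Q t)
          (q' t + ε * -(Real.cos (n * (Real.pi * t)) * q' t)) t := fun t ht =>
        (hqd t ht).add ((hQd t ht).const_mul ε)
      refine antitoneOn_of_deriv_nonpos (convex_Icc _ _)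
        (fun t ht => (hd t ht).continuousAt.continuousWithinAt)
        (fun t ht => (hd t (interior_subset ht)).differentiableAt.differentiableWithinAt)
        fun t ht => ?_
      rw [(hd t (interior_subset ht)).deriv]
      have h1 := hq'0 t (interior_subset ht)
      have h2 : |ε * Real.cos (n * (Real.pi * t))| ≤ 1 := by
        rw [abs_mul]
        exact mul_le_one₀ hε (abs_nonneg _) (Real.abs_cos_le_one _)
      have h3 := (abs_le.1 h2).2
      nlinarith
    have h := hanti (Set.left_mem_Icc.2 hx) (Set.right_mem_Icc.2 hx) hx
    simp only [hQhalf, mul_zero, add_zero] at h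
    exact (hq0 _ (Set.right_mem_Icc.2 hx)).le.trans h
  have hQx : |Q x| ≤ q x := by
    rw [abs_le]
    have h1 := hmono 1 (by simp)
    have h2 := hmono (-1) (by simp)
    constructor <;> linarith
  have hR : |1 / 2 - x - sawtoothSum H x| ≤ 2 * q x := by
    have h1 : 1 / 2 - x - sawtoothSum H x = Q x + Real.cos (n * (Real.pi * x)) * q x := by
      simp only [hQ]
      ring
    have hqx := hq0 x (Set.left_mem_Icc.2 hx)
    have h2 : |Real.cos (n * (Real.pi * x)) * q x| ≤ q x := by
      rw [abs_mul, abs_of_pos hqx]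
      exact mul_le_of_le_one_left hqx.le (Real.abs_cos_le_one _)
    rw [h1]
    refine (abs_add_le _ _).trans ?_
    linarith
  refine hR.trans ?_
  have hs : 2 * x ≤ Real.sin (Real.pi * x) := by
    have := two_mul_min_le_sin_pi_mul hx0.le (by linarith : x ≤ 1)
    rwa [min_eq_left (by linarith)] at this
  calc 2 * q x ≤ 2 * (n * Real.pi * (2 * x))⁻¹ := by
        simp only [hq]
        gcongr
    _ = _ := by field_simp

/-- The Fejér kernel of order `K`, divided by `K`, is at least `1 / 4` for
`|t| ≤ 1 / (13 K)`. -/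
lemma one_fourth_le_fejer {K : ℕ} {t : ℝ} (hK : 1 ≤ K) (ht : 13 * (K * |t|) ≤ 1) :
    1 / 4 ≤ 1 / (K : ℝ) ^ 2 * ‖∑ k ∈ Finset.range K, expTwoPiI (k * t)‖ ^ 2 := by
  have hK0 : (0 : ℝ) < K := by exact_mod_cast hK
  have h1 : ‖∑ k ∈ Finset.range K, expTwoPiI (k * t) - K‖ ≤ K * (1 / 2) := by
    have : ∑ k ∈ Finset.range K, expTwoPiI (k * t) - K
        = ∑ k ∈ Finset.range K, (expTwoPiI (k * t) - expTwoPiI 0) := by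
      simp [expTwoPiI_zero]
    rw [this]
    refine (norm_sum_le_of_le (n := fun _ => (1 / 2 : ℝ)) _ fun k hk => ?_).trans (by simp)
    refine (norm_expTwoPiI_sub_le _ _).trans ?_
    have hkK : (k : ℝ) ≤ K := by exact_mod_cast (Finset.mem_range.1 hk).le
    have h3 : |(k : ℝ) * t - 0| ≤ K * |t| := by
      rw [sub_zero, abs_mul, Nat.abs_cast]
      gcongr
    have := Real.pi_lt_d2
    have := Real.pi_pos
    have h4 : 0 ≤ |(k : ℝ) * t - 0| := abs_nonneg _
    nlinarith
  have h2 : (K : ℝ) / 2 ≤ ‖∑ k ∈ Finset.range K, expTwoPiI (k * t)‖ := by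
    have h3 := norm_sub_norm_le (K : ℂ) (K - ∑ k ∈ Finset.range K, expTwoPiI (k * t))
    rw [sub_sub_cancel, Complex.norm_natCast, norm_sub_rev] at h3
    linarith
  calc (1 / 4 : ℝ) = 1 / (K : ℝ) ^ 2 * ((K : ℝ) / 2) ^ 2 := by
        field_simp
        norm_num
    _ ≤ _ := by gcongr

/-- The sum `∑_{K ≤ H} F_K (t) / K` of normalized Fejér kernels. -/
noncomputable def fejerSum (H : ℕ) (t : ℝ) : ℝ :=
  ∑ K ∈ Finset.Icc 1 H, 1 / (K : ℝ) ^ 2 * ‖∑ k ∈ Finset.range K, expTwoPiI (k * t)‖ ^ 2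

lemma fejerSum_add_intCast (H : ℕ) (t : ℝ) (n : ℤ) : fejerSum H (t + n) = fejerSum H t := by
  unfold fejerSum
  have : ∀ k : ℕ, expTwoPiI (k * (t + n)) = expTwoPiI (k * t) := fun k => by
    rw [mul_add, show (k : ℝ) * (n : ℝ) = ((k * n : ℤ) : ℝ) by push_cast; ring,
      expTwoPiI_add_intCast]
  simp only [this]

lemma div_four_le_fejerSum {n H : ℕ} {t : ℝ} (hn : n ≤ H) (ht : 13 * (n * |t|) ≤ 1) :
    (n : ℝ) / 4 ≤ fejerSum H t := by
  calc (n : ℝ) / 4 = ∑ _K ∈ Finset.Icc 1 n, (1 / 4 : ℝ) := by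
        rw [Finset.sum_const, Nat.card_Icc, nsmul_eq_mul, Nat.add_sub_cancel]
        ring
    _ ≤ ∑ K ∈ Finset.Icc 1 n, 1 / (K : ℝ) ^ 2 * ‖∑ k ∈ Finset.range K, expTwoPiI (k * t)‖ ^ 2 := by
        refine Finset.sum_le_sum fun K hK => one_fourth_le_fejer (Finset.mem_Icc.1 hK).1 ?_
        have : (K : ℝ) ≤ n := by exact_mod_cast (Finset.mem_Icc.1 hK).2
        have := mul_le_mul_of_nonneg_right this (abs_nonneg t)
        linarith
    _ ≤ _ := Finset.sum_le_sum_of_subset_of_nonneg (Finset.Icc_subset_Icc_right hn)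
        fun _ _ _ => by positivity

lemma one_le_fejerSum {H : ℕ} (hH : 1 ≤ H) (t : ℝ) : 1 ≤ fejerSum H t := by
  have := Finset.single_le_sum (f := fun K : ℕ =>
    1 / (K : ℝ) ^ 2 * ‖∑ k ∈ Finset.range K, expTwoPiI (k * t)‖ ^ 2)
    (fun _ _ => by positivity) (Finset.mem_Icc.2 ⟨le_rfl, hH⟩)
  simpa [expTwoPiI_zero, fejerSum] using this

/-- The trivial bound near `0` and the decay of order `1 / (H |t|)` away from `0` together put `E`
below a multiple of the kernel sum divided by `H`. -/
lemma mul_le_fejerSum {H : ℕ} (hH : 1 ≤ H) {t E : ℝ} (hE1 : E ≤ 1 / 2 + 2 * H * |t|)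
    (hE2 : t ≠ 0 → E ≤ 1 / ((2 * H + 1) * Real.pi * |t|)) :
    E ≤ 20 / H * fejerSum H t := by
  have hH0 : (0 : ℝ) < H := by exact_mod_cast hH
  rw [div_mul_eq_mul_div, le_div_iff₀ hH0]
  rcases le_or_gt (13 * (H * |t|)) 1 with h | h
  · have h1 := div_four_le_fejerSum le_rfl h
    nlinarith
  · have ht : t ≠ 0 := by
      rintro rfl
      simp at h
      linarith
    have ht0 : 0 < |t| := abs_pos.2 ht
    have hE3 : E * H ≤ 1 / (6 * |t|) := by
      have hp := Real.pi_gt_three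
      have h3 : E * H ≤ 1 / ((2 * H + 1) * Real.pi * |t|) * H :=
        mul_le_mul_of_nonneg_right (hE2 ht) hH0.le
      refine h3.trans ?_
      rw [div_mul_eq_mul_div, one_mul, div_le_div_iff₀ (by positivity) (by positivity)]
      have : 0 ≤ H * |t| * (Real.pi - 3) := by
        have : 0 ≤ Real.pi - 3 := by linarith
        positivity
      have : 0 ≤ Real.pi * |t| := by positivity
      nlinarith
    -- Only the kernels of order `K ≤ n ≈ 1 / (13 |t|)` are known to be large at `t`.
    rcases le_or_gt (13 * |t|) 1 with h13 | h13
    · set n := ⌊1 / (13 * |t|)⌋₊ with hn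
      have hv : 1 ≤ 1 / (13 * |t|) := by rwa [le_div_iff₀ (by positivity), one_mul]
      have hn1 : (n : ℝ) ≤ 1 / (13 * |t|) := Nat.floor_le (by positivity)
      have hn2 : 1 / (13 * |t|) < n + 1 := Nat.lt_floor_add_one _
      have hn3 : (1 : ℝ) ≤ n := by exact_mod_cast (Nat.one_le_floor_iff _).2 hv
      have hnt : 13 * (n * |t|) ≤ 1 := by
        rw [le_div_iff₀ (by positivity)] at hn1
        linarith
      have hnH : n ≤ H := by
        have h4 : (n : ℝ) * |t| < H * |t| := by linarith
        exact_mod_cast (lt_of_mul_lt_mul_right h4 ht0.le).le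
      have h5 := div_four_le_fejerSum hnH hnt
      have h6 : 1 / (6 * |t|) = 13 / 6 * (1 / (13 * |t|)) := by field_simp
      rw [h6] at hE3
      linarith
    · have h5 := one_le_fejerSum hH t
      have h6 : 1 / (6 * |t|) ≤ 13 / 6 := by
        rw [div_le_iff₀ (by positivity)]
        linarith
      linarith

lemma abs_sawtooth_sub_sawtoothSum_le {H : ℕ} (hH : 1 ≤ H) (y : ℝ) :
    |(⌈y⌉ - y - 1 / 2) - sawtoothSum H y| ≤ 20 / H * fejerSum H y := by
  set t := y - round y with ht
  have hy : y = t + round y := by rw [ht]; ring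
  have hceil : (⌈y⌉ : ℝ) - y = ⌈t⌉ - t := by
    rw [hy, Int.ceil_add_intCast]
    push_cast
    ring
  have habs : |t| ≤ 1 / 2 := abs_sub_round y
  have hS : sawtoothSum H y = sawtoothSum H t := by
    conv_lhs => rw [hy, sawtoothSum_add_intCast]
  have hF : fejerSum H y = fejerSum H t := by
    conv_lhs => rw [hy, fejerSum_add_intCast]
  rw [hceil, hS, hF]
  have hsmall : |(⌈t⌉ : ℝ) - t - 1 / 2| ≤ 1 / 2 := by
    rw [abs_le]
    constructor <;> linarith [Int.le_ceil t, Int.ceil_lt_add_one t]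
  refine mul_le_fejerSum hH ?_ fun h0 => ?_
  · refine (abs_sub _ _).trans ?_
    linarith [abs_sawtoothSum_le H t]
  · rcases lt_or_gt_of_ne h0 with h | h
    · have hc : ⌈t⌉ = 0 := by
        rw [Int.ceil_eq_iff]
        rw [abs_of_neg h] at habs
        constructor
        · push_cast; linarith
        · push_cast; linarith
      have := abs_sub_sawtoothSum_le H (neg_pos.2 h) (by rwa [abs_of_neg h] at habs)
      rw [abs_of_neg h, hc]
      refine le_trans (le_of_eq ?_) this
      rw [sawtoothSum_neg, ← abs_neg]
      congr 1
      push_cast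
      ring
    · have hc : ⌈t⌉ = 1 := by
        rw [Int.ceil_eq_iff]
        rw [abs_of_pos h] at habs
        constructor
        · push_cast; linarith
        · push_cast; linarith
      have := abs_sub_sawtoothSum_le H h (by rwa [abs_of_pos h] at habs)
      rw [abs_of_pos h, hc]
      refine le_trans (le_of_eq ?_) this
      congr 1
      push_cast
      ring

/-! ### The error of the Fourier approximation on average -/

lemma conj_expTwoPiI (t : ℝ) : (starRingEnd ℂ) (expTwoPiI t) = expTwoPiI (-t) := by
  rw [expTwoPiI_eq, expTwoPiI_eq, ← Complex.exp_conj, map_mul, Complex.conj_I, Complex.conj_ofReal]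
  congr 1
  push_cast
  ring

/-- Expanding the square gives `K` diagonal terms, and each frequency difference occurs fewer than
`2 K` times. -/
lemma sum_norm_sq_sum_expTwoPiI_le {ι : Type*} (s : Finset ι) (y : ι → ℝ) {K H : ℕ} (hK : K ≤ H) :
    ∑ m ∈ s, ‖∑ k ∈ Finset.range K, expTwoPiI (k * y m)‖ ^ 2
      ≤ K * (s.card + 2 * ∑ h ∈ Finset.Icc 1 H, ‖∑ m ∈ s, expTwoPiI (h * y m)‖) := by
  induction K with
  | zero => simp
  | succ K ih =>
    have hexp : ∀ m ∈ s, ‖∑ k ∈ Finset.range (K + 1), expTwoPiI (k * y m)‖ ^ 2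
        = ‖∑ k ∈ Finset.range K, expTwoPiI (k * y m)‖ ^ 2 + 1
          + 2 * (∑ k ∈ Finset.range K, expTwoPiI ((K - k : ℕ) * y m)).re := by
      intro m _
      rw [Finset.sum_range_succ, add_comm (∑ k ∈ Finset.range K, expTwoPiI (k * y m)),
        ← Complex.normSq_eq_norm_sq, ← Complex.normSq_eq_norm_sq, Complex.normSq_add,
        Complex.normSq_eq_norm_sq (expTwoPiI _), norm_expTwoPiI, map_sum (starRingEnd ℂ), Finset.mul_sum]
      have : ∀ k ∈ Finset.range K, expTwoPiI (K * y m) * (starRingEnd ℂ) (expTwoPiI (k * y m))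
          = expTwoPiI ((K - k : ℕ) * y m) := fun k hk => by
        rw [conj_expTwoPiI, ← expTwoPiI_add, Nat.cast_sub (Finset.mem_range.1 hk).le]
        congr 1
        ring
      rw [Finset.sum_congr rfl this]
      ring
    rw [Finset.sum_congr rfl hexp, Finset.sum_add_distrib, Finset.sum_add_distrib, ← Finset.mul_sum,
      Finset.sum_const, nsmul_eq_mul, mul_one]
    have hoff : ∑ m ∈ s, (∑ k ∈ Finset.range K, expTwoPiI ((K - k : ℕ) * y m)).re
        ≤ ∑ h ∈ Finset.Icc 1 H, ‖∑ m ∈ s, expTwoPiI (h * y m)‖ := by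
      rw [← Complex.re_sum, Finset.sum_comm]
      refine (Complex.re_le_norm _).trans ((norm_sum_le _ _).trans ?_)
      have h1 : ∑ k ∈ Finset.range K, ‖∑ m ∈ s, expTwoPiI ((K - k : ℕ) * y m)‖
          = ∑ h ∈ Finset.Icc 1 K, ‖∑ m ∈ s, expTwoPiI (h * y m)‖ := by
        refine Finset.sum_nbij' (fun k => K - k) (fun h => K - h) ?_ ?_ ?_ ?_ ?_ <;>
          simp only [Finset.mem_range, Finset.mem_Icc] <;> intros <;> first | omega | trivial
      rw [h1]
      exact Finset.sum_le_sum_of_subset_of_nonneg (Finset.Icc_subset_Icc_right (by omega))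
        fun _ _ _ => norm_nonneg _
    have := ih (by omega)
    push_cast
    linarith

lemma sum_Icc_one_div_le (H : ℕ) : ∑ K ∈ Finset.Icc 1 H, 1 / (K : ℝ) ≤ 1 + Real.log H := by
  have h := harmonic_le_one_add_log H
  rw [harmonic_eq_sum_Icc] at h
  push_cast at h
  simpa [one_div] using h

lemma sum_fejerSum_le {ι : Type*} (s : Finset ι) (y : ι → ℝ) (H : ℕ) :
    ∑ m ∈ s, fejerSum H (y m)
      ≤ (1 + Real.log H)
        * (s.card + 2 * ∑ h ∈ Finset.Icc 1 H, ‖∑ m ∈ s, expTwoPiI (h * y m)‖) := by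
  set R := (s.card : ℝ) + 2 * ∑ h ∈ Finset.Icc 1 H, ‖∑ m ∈ s, expTwoPiI (h * y m)‖ with hR
  have hR0 : 0 ≤ R := by positivity
  unfold fejerSum
  rw [Finset.sum_comm]
  refine le_trans (Finset.sum_le_sum (g := fun K : ℕ => 1 / (K : ℝ) * R) fun K hK => ?_) ?_
  · have hK0 : (0 : ℝ) < K := by exact_mod_cast (Finset.mem_Icc.1 hK).1
    rw [← Finset.mul_sum]
    calc _ ≤ 1 / (K : ℝ) ^ 2 * (K * R) := by
          gcongr
          exact sum_norm_sq_sum_expTwoPiI_le s y (Finset.mem_Icc.1 hK).2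
      _ = _ := by field_simp
  · rw [← Finset.sum_mul]
    exact mul_le_mul_of_nonneg_right (sum_Icc_one_div_le H) hR0

lemma fejerSum_nonneg (H : ℕ) (t : ℝ) : 0 ≤ fejerSum H t :=
  Finset.sum_nonneg fun _ _ => by positivity

lemma rpow_two_sub_div_mul_eq {γ M h : ℝ} (hM : 0 < M) (hh : 0 < h) :
    M ^ (2 - γ) / h * (h * M ^ (γ - 1)) = M := by
  have : M ^ (2 - γ) * M ^ (γ - 1) = M := by
    rw [← Real.rpow_add hM]
    norm_num
  field_simp
  exact this

lemma integral_blockMajorant_div_nonneg (f : ℕ → ℂ) {D : ℝ} (hD : 0 ≤ D) (Z : ℕ) :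
    0 ≤ (∫ θ in (0 : ℝ)..1, blockMajorant f D Z θ) / Z :=
  div_nonneg (intervalIntegral.integral_nonneg (by norm_num)
    fun θ _ => blockMajorant_nonneg f hD Z θ) Z.cast_nonneg

/-- The total error of the Fourier approximation: the constant terms of the Fejér kernels give
`M / H`, the others are exponential sums without coefficients. -/
lemma sum_fejerSum_rpow_le {γ D Y : ℝ} {M M' H Z : ℕ} (hγ : γ ∈ Set.Ioo (0 : ℝ) 1)
    (hM : 1 ≤ M) (hMM : M ≤ M') (hM' : M' ≤ 4 * M) (hZ : 1 ≤ Z) (hH : 1 ≤ H)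
    (hMH : (M : ℝ) ^ (1 - γ) ≤ H) (hD0 : 0 ≤ D)
    (hD : 2 * Real.pi * (H * (M : ℝ) ^ (γ - 2) * Z) ≤ D / Z)
    (hY : (∫ θ in (0 : ℝ)..1, blockMajorant (fun _ => 1) D Z θ) / Z ≤ Y) :
    20 / H * ∑ m ∈ Finset.Ioc M M', fejerSum H ((m : ℝ) ^ γ)
      ≤ 80 * (1 + Real.log H) ^ 2 * (32 / (γ * (1 - γ)) * M * Y + Z + M / H) := by
  have hM0 : (0 : ℝ) < M := by exact_mod_cast hM
  have hH0 : (0 : ℝ) < H := by exact_mod_cast hH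
  have hZ0 : (0 : ℝ) < Z := by exact_mod_cast hZ
  have hγ' : 0 < γ * (1 - γ) := mul_pos hγ.1 (by linarith [hγ.2])
  set κ := 32 / (γ * (1 - γ)) with hκ
  have hκ0 : 0 < κ := by positivity
  have hY0 : 0 ≤ Y := (integral_blockMajorant_div_nonneg _ hD0 Z).trans hY
  set l := 1 + Real.log H with hl
  have hl1 : 1 ≤ l := by
    have := Real.log_nonneg (show (1 : ℝ) ≤ H by exact_mod_cast hH)
    linarith
  have hV : ∀ h ∈ Finset.Icc 1 H, ‖∑ m ∈ Finset.Ioc M M', expTwoPiI (h * (m : ℝ) ^ γ)‖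
      ≤ (κ * M * Y + 2 * Z) + κ * M * H * Y * (1 / h) := by
    intro h hh
    have hh0 : (0 : ℝ) < h := by exact_mod_cast (Finset.mem_Icc.1 hh).1
    have hhH : (h : ℝ) ≤ H := by exact_mod_cast (Finset.mem_Icc.1 hh).2
    have key := norm_sum_Ioc_rpow_phase_le (f := fun _ => 1) (by simp) (A := 1) (b := 0)
      (W := fun _ => 1) hγ hh0.ne' hM hMM hM' hZ hD0 (by simp) (by simp) (by
        rw [add_zero, abs_of_pos hh0]
        refine le_trans ?_ hD
        have := Real.pi_pos
        gcongr)
    simp only [one_mul, mul_one] at key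
    rw [abs_of_pos hh0] at key
    refine key.trans ?_
    have h1 : (M : ℝ) ^ (2 - γ) / h * (h * (M : ℝ) ^ (γ - 1) + 1) ≤ M + M * H * (1 / h) := by
      rw [mul_add, rpow_two_sub_div_mul_eq hM0 hh0, mul_one]
      have h2 : (M : ℝ) ^ (2 - γ) = M * (M : ℝ) ^ (1 - γ) := by
        conv_rhs => rw [← Real.rpow_one_add' hM0.le (by linarith [hγ.2])]
        congr 1
        ring
      rw [h2, div_eq_mul_one_div]
      gcongr
    calc _ = κ * ((M : ℝ) ^ (2 - γ) / h * (h * (M : ℝ) ^ (γ - 1) + 1))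
          * ((∫ θ in (0 : ℝ)..1, blockMajorant (fun _ => 1) D Z θ) / Z) + 2 * Z := by ring
      _ ≤ κ * (M + M * H * (1 / h)) * Y + 2 * Z := by
          have := integral_blockMajorant_div_nonneg (fun _ => 1) hD0 Z
          gcongr
      _ = _ := by ring
  have hVs : ∑ h ∈ Finset.Icc 1 H, ‖∑ m ∈ Finset.Ioc M M', expTwoPiI (h * (m : ℝ) ^ γ)‖
      ≤ H * (2 * κ * M * Y * l + 2 * Z) := by
    refine (Finset.sum_le_sum hV).trans ?_
    rw [Finset.sum_add_distrib, ← Finset.mul_sum, Finset.sum_const, Nat.card_Icc, nsmul_eq_mul,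
      Nat.add_sub_cancel]
    have h1 := sum_Icc_one_div_le H
    have h2 : κ * M * Y * 1 ≤ κ * M * Y * l := by gcongr
    calc _ ≤ H * (κ * M * Y + 2 * Z) + κ * M * H * Y * l := by gcongr
      _ ≤ _ := by nlinarith
  have hcard : ((Finset.Ioc M M').card : ℝ) ≤ 3 * M := by
    rw [Nat.card_Ioc]
    exact_mod_cast (by omega : M' - M ≤ 3 * M)
  have hmain := sum_fejerSum_le (Finset.Ioc M M') (fun m : ℕ => (m : ℝ) ^ γ) H
  have hq : 0 ≤ κ * M * Y := by positivity
  have hr : 0 ≤ (M : ℝ) / H := by positivity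
  calc _ ≤ 20 / H * (l * (3 * M + 2 * (H * (2 * κ * M * Y * l + 2 * Z)))) := by
        refine mul_le_mul_of_nonneg_left (hmain.trans ?_) (by positivity)
        gcongr
    _ = 20 * l * (3 * (M / H) + 4 * (κ * M * Y) * l + 4 * Z) := by
        field_simp
        ring
    _ ≤ 20 * l * (4 * (M / H) * l + 4 * (κ * M * Y) * l + 4 * Z * l) := by
        have h1 : (M : ℝ) / H * 1 ≤ M / H * l := by gcongr
        have h2 : (Z : ℝ) * 1 ≤ Z * l := by gcongr
        refine mul_le_mul_of_nonneg_left ?_ (by positivity)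
        linarith
    _ = _ := by ring

/-! ### The main part of the Fourier approximation -/

/-- For small `h` the difference `e(h (m + 1) ^ γ) - e(h m ^ γ)` is small, of order
`h M ^ (γ - 1)`; this saving makes the contributions of all frequencies comparable. -/
lemma norm_sum_expTwoPiI_diff_le {f : ℕ → ℂ} (hf : ∀ n, ‖f n‖ ≤ 1) {γ h D Y : ℝ} {M M' Z : ℕ}
    (hγ : γ ∈ Set.Ioo (0 : ℝ) 1) (hh : h ≠ 0) (hM : 1 ≤ M) (hMM : M ≤ M') (hM' : M' ≤ 4 * M)
    (hZ : 1 ≤ Z) (hD0 : 0 ≤ D)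
    (hD : 2 * Real.pi * (|h| * (M : ℝ) ^ (γ - 2) * Z) + (2 * (|h| * (M : ℝ) ^ (γ - 2)) + 2 / M)
      ≤ D / Z)
    (hY : (∫ θ in (0 : ℝ)..1, blockMajorant f D Z θ) / Z ≤ Y) :
    ‖∑ m ∈ Finset.Ioc M M',
        f m * (expTwoPiI (h * ((m : ℝ) + 1) ^ γ) - expTwoPiI (h * (m : ℝ) ^ γ))‖
      ≤ 14 * (32 / (γ * (1 - γ)) * M * Y + Z) := by
  have hM0 : (0 : ℝ) < M := by exact_mod_cast hM
  have hh0 : 0 < |h| := abs_pos.2 hh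
  have hγ' : 0 < γ * (1 - γ) := mul_pos hγ.1 (by linarith [hγ.2])
  have hZ0 : (0 : ℝ) < Z := by exact_mod_cast hZ
  have hY0 : 0 ≤ Y := (integral_blockMajorant_div_nonneg _ hD0 Z).trans hY
  have hπ := Real.pi_pos
  have hπ2 := Real.pi_lt_d2
  set u : ℝ := |h| * (M : ℝ) ^ (γ - 1) with hu
  have hu0 : 0 < u := by positivity
  have huM : |h| * (M : ℝ) ^ (γ - 2) = u / M := by
    have : (M : ℝ) ^ (γ - 1) = (M : ℝ) ^ (γ - 2) * M := by
      rw [← Real.rpow_add_one hM0.ne']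
      congr 1
      ring
    rw [hu, this]
    field_simp
  set W : ℕ → ℂ := fun m => expTwoPiI (h * (((m : ℝ) + 1) ^ γ - (m : ℝ) ^ γ)) - expTwoPiI 0 with hW
  have hfac : ∀ m : ℕ, expTwoPiI (h * ((m : ℝ) + 1) ^ γ) - expTwoPiI (h * (m : ℝ) ^ γ)
      = expTwoPiI (h * (m : ℝ) ^ γ) * W m := fun m => by
    rw [hW, mul_sub (expTwoPiI _), ← expTwoPiI_add, ← expTwoPiI_add]
    ring_nf
  simp only [hfac]
  -- The weight has size `min 1 u`, and `u + 1` bounds the number of periods of the slope.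
  have hmin1 : min 1 u * (u + 1) ≤ 2 * u := by
    rcases le_total 1 u with h1 | h1
    · rw [min_eq_left h1]; linarith
    · rw [min_eq_right h1]; nlinarith
  have hmin2 : u ≤ min 1 u * (u + 1) := by
    rcases le_total 1 u with h1 | h1
    · rw [min_eq_left h1]; linarith
    · rw [min_eq_right h1]; nlinarith
  have hWA : ∀ m, M ≤ m → ‖W m‖ ≤ 7 * min 1 u := by
    intro m hm
    have hmM : (M : ℝ) ≤ m := by exact_mod_cast hm
    have h1 : ‖W m‖ ≤ 2 := by
      refine (norm_sub_le _ _).trans ?_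
      rw [norm_expTwoPiI, norm_expTwoPiI]
      norm_num
    have h2 : ‖W m‖ ≤ 7 * u := by
      refine (norm_expTwoPiI_sub_le _ _).trans ?_
      rw [sub_zero, abs_mul]
      have h3 := abs_add_one_rpow_sub_rpow_le hγ hM0 hmM
      calc 2 * Real.pi * (|h| * |((m : ℝ) + 1) ^ γ - (m : ℝ) ^ γ|)
          ≤ 7 * (|h| * (M : ℝ) ^ (γ - 1)) := by
            gcongr
            linarith
        _ = _ := rfl
    rw [mul_min_of_nonneg _ _ (by norm_num)]
    exact le_min (by linarith) h2
  have hdW : ∀ m, M ≤ m →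
      ‖W (m + 1) - W m‖ ≤ 7 * min 1 u * (2 * (|h| * (M : ℝ) ^ (γ - 2)) + 2 / M) := by
    intro m hm
    have hmM : (M : ℝ) ≤ m := by exact_mod_cast hm
    obtain ⟨ξ, hξ, hξe⟩ := exists_add_one_rpow_sub_rpow_eq (γ := γ) (hM0.trans_le hmM)
    obtain ⟨ξ', hξ', hξe'⟩ := exists_add_one_rpow_sub_rpow_eq (γ := γ)
      (show 0 < (m : ℝ) + 1 by linarith)
    have h1 : W (m + 1) - W m = expTwoPiI (h * (γ * ξ' ^ (γ - 1))) - expTwoPiI (h * (γ * ξ ^ (γ - 1))) := by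
      rw [← hξe, ← hξe']
      simp only [hW]
      push_cast
      ring
    rw [h1]
    refine (norm_expTwoPiI_sub_le _ _).trans ?_
    rw [← mul_sub, abs_mul]
    have h2 : |γ * ξ' ^ (γ - 1) - γ * ξ ^ (γ - 1)| ≤ (M : ℝ) ^ (γ - 2) * 2 := by
      refine (abs_mul_rpow_sub_mul_rpow_le hγ hM0 (by linarith [hξ'.1]) (by linarith [hξ.1])).trans ?_
      gcongr
      rw [abs_le]
      constructor <;> linarith [hξ.1, hξ.2, hξ'.1, hξ'.2]
    calc 2 * Real.pi * (|h| * |γ * ξ' ^ (γ - 1) - γ * ξ ^ (γ - 1)|)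
        ≤ 7 * (|h| * ((M : ℝ) ^ (γ - 2) * 2)) := by
          gcongr
          linarith
      _ = 14 * (u / M) := by rw [← huM]; ring
      _ ≤ 14 * ((min 1 u * (u + 1)) / M) := by gcongr
      _ = _ := by rw [huM]; ring
  refine (norm_sum_Ioc_rpow_phase_le hf hγ hh hM hMM hM' hZ hD0 hWA hdW hD).trans ?_
  set κ := 32 / (γ * (1 - γ)) with hκ
  have hκ0 : 0 < κ := by positivity
  have hmin0 : 0 < min 1 u := lt_min one_pos hu0
  have hMu : (M : ℝ) ^ (2 - γ) / |h| * u = M := rpow_two_sub_div_mul_eq hM0 hh0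
  calc _ ≤ 7 * min 1 u * (κ * ((M : ℝ) ^ (2 - γ) / |h|) * (u + 1) * Y + 2 * Z) := by gcongr
    _ = 7 * (κ * ((M : ℝ) ^ (2 - γ) / |h|) * (min 1 u * (u + 1)) * Y) + 14 * (min 1 u * Z) := by ring
    _ ≤ 7 * (κ * ((M : ℝ) ^ (2 - γ) / |h|) * (2 * u) * Y) + 14 * (1 * Z) := by
        gcongr
        exact min_le_left _ _
    _ = 14 * (κ * ((M : ℝ) ^ (2 - γ) / |h| * u) * Y + Z) := by ring
    _ = _ := by rw [hMu]

/-- Here the contributions of `h` and `-h` carry the Fourier coefficient, of size `1 / (2 π h)`. -/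
lemma norm_sum_sawtoothSum_diff_le {f : ℕ → ℂ} (hf : ∀ n, ‖f n‖ ≤ 1) {γ D Y : ℝ} {M M' H Z : ℕ}
    (hγ : γ ∈ Set.Ioo (0 : ℝ) 1) (hM : 1 ≤ M) (hMM : M ≤ M') (hM' : M' ≤ 4 * M)
    (hZ : 1 ≤ Z) (hD0 : 0 ≤ D)
    (hD : 2 * Real.pi * (H * (M : ℝ) ^ (γ - 2) * Z) + (2 * (H * (M : ℝ) ^ (γ - 2)) + 2 / M)
      ≤ D / Z)
    (hY : (∫ θ in (0 : ℝ)..1, blockMajorant f D Z θ) / Z ≤ Y) :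
    ‖∑ m ∈ Finset.Ioc M M', f m *
        ((sawtoothSum H (((m : ℝ) + 1) ^ γ) - sawtoothSum H ((m : ℝ) ^ γ) : ℝ) : ℂ)‖
      ≤ 5 * (1 + Real.log H) * (32 / (γ * (1 - γ)) * M * Y + Z) := by
  have hM0 : (0 : ℝ) < M := by exact_mod_cast hM
  have hZ0 : (0 : ℝ) < Z := by exact_mod_cast hZ
  have hγ' : 0 < γ * (1 - γ) := mul_pos hγ.1 (by linarith [hγ.2])
  have hY0 : 0 ≤ Y := (integral_blockMajorant_div_nonneg _ hD0 Z).trans hY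
  set U := 32 / (γ * (1 - γ)) * M * Y + Z with hU
  have hU0 : 0 ≤ U := by positivity
  set S : ℝ → ℂ := fun h => ∑ m ∈ Finset.Ioc M M',
    f m * (expTwoPiI (h * ((m : ℝ) + 1) ^ γ) - expTwoPiI (h * (m : ℝ) ^ γ)) with hS
  have hsplit : ∑ m ∈ Finset.Ioc M M', f m *
        ((sawtoothSum H (((m : ℝ) + 1) ^ γ) - sawtoothSum H ((m : ℝ) ^ γ) : ℝ) : ℂ)
      = ∑ h ∈ Finset.Icc 1 H, (S h - S (-h)) / (2 * Complex.I * (Real.pi * h)) := by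
    simp only [hS, ← Finset.sum_sub_distrib, Finset.sum_div]
    rw [Finset.sum_comm]
    refine Finset.sum_congr rfl fun m _ => ?_
    simp only [sawtoothSum]
    rw [← Finset.sum_sub_distrib, Complex.ofReal_sum, Finset.mul_sum]
    refine Finset.sum_congr rfl fun h _ => ?_
    rw [← sub_div, Complex.ofReal_div, Complex.ofReal_sub, sin_two_pi_mul_eq, sin_two_pi_mul_eq,
      neg_mul, neg_mul, ← sub_div, div_div]
    push_cast
    ring
  have hbound : ∀ h ∈ Finset.Icc 1 H,
      ‖(S h - S (-h)) / (2 * Complex.I * (Real.pi * h))‖ ≤ 5 * U * (1 / h) := by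
    intro h hh
    have hh0 : (0 : ℝ) < h := by exact_mod_cast (Finset.mem_Icc.1 hh).1
    have hhH : (h : ℝ) ≤ H := by exact_mod_cast (Finset.mem_Icc.1 hh).2
    have hπ := Real.pi_pos
    have hDh : 2 * Real.pi * (h * (M : ℝ) ^ (γ - 2) * Z) + (2 * (h * (M : ℝ) ^ (γ - 2)) + 2 / M)
        ≤ D / Z := by
      refine le_trans ?_ hD
      gcongr
    have h1 : ‖S h‖ ≤ 14 * U :=
      norm_sum_expTwoPiI_diff_le hf hγ hh0.ne' hM hMM hM' hZ hD0
        (by rwa [abs_of_pos hh0]) hY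
    have h2 : ‖S (-h)‖ ≤ 14 * U :=
      norm_sum_expTwoPiI_diff_le hf hγ (neg_ne_zero.2 hh0.ne') hM hMM hM' hZ hD0
        (by rwa [abs_neg, abs_of_pos hh0]) hY
    have h3 : ‖2 * Complex.I * ((Real.pi : ℂ) * h)‖ = 2 * (Real.pi * h) := by
      simp [abs_of_pos hπ]
    rw [norm_div, h3, div_le_iff₀ (by positivity)]
    refine (norm_sub_le _ _).trans ?_
    have h4 : 5 * U * (1 / h) * (2 * (Real.pi * h)) = 10 * U * Real.pi := by
      field_simp
      ring
    rw [h4]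
    nlinarith [Real.pi_gt_three]
  rw [hsplit]
  refine (norm_sum_le_of_le _ hbound).trans ?_
  rw [← Finset.mul_sum]
  calc _ ≤ 5 * U * (1 + Real.log H) := by
        gcongr
        exact sum_Icc_one_div_le H
    _ = _ := by ring

/-- The constant `-1 / 2` of the sawtooth function cancels in the difference. -/
lemma norm_sum_sawtooth_diff_le {f : ℕ → ℂ} (hf : ∀ n, ‖f n‖ ≤ 1) {γ D Y : ℝ} {M M' H Z : ℕ}
    (hγ : γ ∈ Set.Ioo (0 : ℝ) 1) (hM : 1 ≤ M) (hMM : M ≤ M') (hM' : M' + 1 ≤ 4 * M)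
    (hZ : 1 ≤ Z) (hH : 1 ≤ H) (hMH : (M : ℝ) ^ (1 - γ) ≤ H) (hD0 : 0 ≤ D)
    (hD : 2 * Real.pi * (H * (M : ℝ) ^ (γ - 2) * Z) + (2 * (H * (M : ℝ) ^ (γ - 2)) + 2 / M)
      ≤ D / Z)
    (hYf : (∫ θ in (0 : ℝ)..1, blockMajorant f D Z θ) / Z ≤ Y)
    (hY1 : (∫ θ in (0 : ℝ)..1, blockMajorant (fun _ => 1) D Z θ) / Z ≤ Y) :
    ‖∑ m ∈ Finset.Ioc M M', f m *
        (((⌈((m : ℝ) + 1) ^ γ⌉ - ((m : ℝ) + 1) ^ γ) - (⌈(m : ℝ) ^ γ⌉ - (m : ℝ) ^ γ) : ℝ) : ℂ)‖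
      ≤ 165 * (1 + Real.log H) ^ 2 * (32 / (γ * (1 - γ)) * M * Y + Z + M / H) := by
  have hM0 : (0 : ℝ) < M := by exact_mod_cast hM
  have hZ0 : (0 : ℝ) < Z := by exact_mod_cast hZ
  have hH0 : (0 : ℝ) < H := by exact_mod_cast hH
  have hγ' : 0 < γ * (1 - γ) := mul_pos hγ.1 (by linarith [hγ.2])
  have hY0 : 0 ≤ Y := (integral_blockMajorant_div_nonneg _ hD0 Z).trans hYf
  have hl1 : 1 ≤ 1 + Real.log H := by
    have := Real.log_nonneg (show (1 : ℝ) ≤ H by exact_mod_cast hH)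
    linarith
  have hπ := Real.pi_pos
  have hD' : 2 * Real.pi * (H * (M : ℝ) ^ (γ - 2) * Z) ≤ D / Z :=
    le_trans (le_add_of_nonneg_right (by positivity)) hD
  set r : ℝ → ℝ := fun y => (⌈y⌉ - y - 1 / 2) - sawtoothSum H y with hr
  have hrle : ∀ y, |r y| ≤ 20 / H * fejerSum H y := abs_sawtooth_sub_sawtoothSum_le hH
  have hsplit : ∑ m ∈ Finset.Ioc M M', f m *
        (((⌈((m : ℝ) + 1) ^ γ⌉ - ((m : ℝ) + 1) ^ γ) - (⌈(m : ℝ) ^ γ⌉ - (m : ℝ) ^ γ) : ℝ) : ℂ)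
      = ∑ m ∈ Finset.Ioc M M', f m *
          ((sawtoothSum H (((m : ℝ) + 1) ^ γ) - sawtoothSum H ((m : ℝ) ^ γ) : ℝ) : ℂ)
        + ∑ m ∈ Finset.Ioc M M', f m * ((r (((m : ℝ) + 1) ^ γ) - r ((m : ℝ) ^ γ) : ℝ) : ℂ) := by
    rw [← Finset.sum_add_distrib]
    refine Finset.sum_congr rfl fun m _ => ?_
    rw [← mul_add, ← Complex.ofReal_add]
    congr 2
    simp only [hr]
    ring
  have hmain := norm_sum_sawtoothSum_diff_le hf (H := H) hγ hM hMM (by omega) hZ hD0 hD hYf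
  have herr : ‖∑ m ∈ Finset.Ioc M M', f m * ((r (((m : ℝ) + 1) ^ γ) - r ((m : ℝ) ^ γ) : ℝ) : ℂ)‖
      ≤ 20 / H * ∑ m ∈ Finset.Ioc M (M' + 1), fejerSum H ((m : ℝ) ^ γ)
        + 20 / H * ∑ m ∈ Finset.Ioc M M', fejerSum H ((m : ℝ) ^ γ) := by
    have h1 : ∀ m ∈ Finset.Ioc M M',
        ‖f m * ((r (((m : ℝ) + 1) ^ γ) - r ((m : ℝ) ^ γ) : ℝ) : ℂ)‖
          ≤ 20 / H * fejerSum H (((m + 1 : ℕ) : ℝ) ^ γ) + 20 / H * fejerSum H ((m : ℝ) ^ γ) := by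
      intro m _
      rw [norm_mul, Complex.norm_real, Real.norm_eq_abs]
      refine (mul_le_of_le_one_left (abs_nonneg _) (hf m)).trans ((abs_sub _ _).trans ?_)
      push_cast
      exact add_le_add (hrle _) (hrle _)
    refine (norm_sum_le_of_le _ h1).trans ?_
    rw [Finset.sum_add_distrib, ← Finset.mul_sum, ← Finset.mul_sum]
    gcongr ?_ + _
    refine mul_le_mul_of_nonneg_left ?_ (by positivity)
    rw [← Finset.sum_image (f := fun m : ℕ => fejerSum H ((m : ℝ) ^ γ)) (g := fun m => m + 1)
      (by simp)]
    refine Finset.sum_le_sum_of_subset_of_nonneg (fun n hn => ?_) fun _ _ _ => fejerSum_nonneg _ _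
    obtain ⟨m, hm, rfl⟩ := Finset.mem_image.1 hn
    rw [Finset.mem_Ioc] at hm ⊢
    omega
  have he1 := sum_fejerSum_rpow_le hγ hM hMM (by omega) hZ hH hMH hD0 hD' hY1
  have he2 := sum_fejerSum_rpow_le hγ hM (by omega : M ≤ M' + 1) hM' hZ hH hMH hD0 hD' hY1
  rw [hsplit]
  refine (norm_add_le _ _).trans ?_
  set l := 1 + Real.log H with hl
  set U := 32 / (γ * (1 - γ)) * M * Y + Z with hU
  have hU0 : 0 ≤ U := by positivity
  have hq : 0 ≤ (M : ℝ) / H := by positivity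
  have h5 : 5 * l * U ≤ 5 * l ^ 2 * (U + M / H) := by
    have : l * U ≤ l ^ 2 * (U + M / H) := by
      apply mul_le_mul _ (by linarith) hU0 (by positivity)
      nlinarith
    linarith
  linarith

/-! ### Choice of parameters and dyadic summation -/

lemma natCeil_le_two_mul {x : ℝ} (hx : 1 ≤ x) : (⌈x⌉₊ : ℝ) ≤ 2 * x := by
  linarith [(Nat.ceil_lt_add_one (by linarith : 0 ≤ x)).le]

lemma two_add_log_sq_le {ε x : ℝ} (hε : 0 < ε) (hx : 1 ≤ x) :
    (2 + Real.log x) ^ 2 ≤ (2 + 2 / ε) ^ 2 * x ^ ε := by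
  have h1 : Real.log x ≤ x ^ (ε / 2) / (ε / 2) :=
    Real.log_le_rpow_div (by linarith) (by positivity)
  have h2 : 1 ≤ x ^ (ε / 2) := Real.one_le_rpow hx (by positivity)
  have h3 : x ^ ε = (x ^ (ε / 2)) ^ 2 := by
    rw [← Real.rpow_natCast, ← Real.rpow_mul (by linarith)]
    congr 1
    push_cast
    ring
  rw [h3, ← mul_pow]
  have h4 : x ^ (ε / 2) / (ε / 2) = 2 / ε * x ^ (ε / 2) := by
    field_simp
  have := Real.log_nonneg hx
  gcongr
  linarith

/-- With `Z ≈ M ^ ((1 - s) / 2)` and `H ≈ M ^ (1 - γ + s)` the curvature of the phases `h m ^ γ`,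
`h ≤ H`, is bounded on blocks of length `Z`, and all error terms are `O(M ^ (γ - s) log² M)`. -/
lemma exists_dyadic_sawtooth_bound {a C γ s ρ : ℝ} (ha : a ∈ Set.Ioc (0 : ℝ) 1) (hC : 0 ≤ C)
    (hγ : γ ∈ Set.Ioo (0 : ℝ) 1) (hs : s ∈ Set.Ioo 0 γ)
    (has : 1 - (1 - a) * ((1 - s) / 2) ≤ γ - s) (hρ : γ - s < ρ) :
    ∃ B : ℝ, 0 ≤ B ∧ ∀ f : ℕ → ℂ, (∀ n, ‖f n‖ ≤ 1) →
      (∀ j : ℕ, 1 ≤ j → ∫ θ in (0 : ℝ)..1, supShortExpSum f j θ ≤ C * (j : ℝ) ^ a) →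
      ∀ M M' : ℕ, 1 ≤ M → M ≤ M' → M' ≤ 2 * M + 1 →
        ‖∑ m ∈ Finset.Ioc M M', f m *
          (((⌈((m : ℝ) + 1) ^ γ⌉ - ((m : ℝ) + 1) ^ γ) - (⌈(m : ℝ) ^ γ⌉ - (m : ℝ) ^ γ) : ℝ) : ℂ)‖
          ≤ B * (M : ℝ) ^ ρ := by
  obtain ⟨ha0, ha1⟩ := ha
  obtain ⟨hγ0, hγ1⟩ := hγ
  obtain ⟨hs0, hsγ⟩ := hs
  have hγ' : 0 < γ * (1 - γ) := mul_pos hγ0 (by linarith)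
  set κ := 32 / (γ * (1 - γ)) with hκ
  have hκ0 : 0 < κ := by positivity
  set C' := max C (2 / a) with hC'
  have hC'0 : 0 ≤ C' := hC.trans (le_max_left _ _)
  set ε := ρ - (γ - s) with hε
  have hε0 : 0 < ε := by linarith
  refine ⟨165 * (2 + 2 / ε) ^ 2 * (κ * (101 * C') + 3), by positivity, ?_⟩
  intro f hf hI M M' hM hMM hM'
  have hM1 : (1 : ℝ) ≤ M := by exact_mod_cast hM
  have hM0 : (0 : ℝ) < M := by linarith
  set σ := 1 - γ + s with hσ
  set τ := (1 - s) / 2 with hτ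
  have hσ0 : 1 ≤ (M : ℝ) ^ σ := Real.one_le_rpow hM1 (by linarith)
  have hτ0 : 1 ≤ (M : ℝ) ^ τ := Real.one_le_rpow hM1 (by linarith)
  set H := ⌈(M : ℝ) ^ σ⌉₊ with hH
  set Z := ⌈(M : ℝ) ^ τ⌉₊ with hZ
  have hHle : (M : ℝ) ^ σ ≤ H := Nat.le_ceil _
  have hZle : (M : ℝ) ^ τ ≤ Z := Nat.le_ceil _
  have hH2 : (H : ℝ) ≤ 2 * (M : ℝ) ^ σ := natCeil_le_two_mul hσ0
  have hZ2 : (Z : ℝ) ≤ 2 * (M : ℝ) ^ τ := natCeil_le_two_mul hτ0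
  have hH1 : 1 ≤ H := by exact_mod_cast hσ0.trans hHle
  have hZ1 : 1 ≤ Z := by exact_mod_cast hτ0.trans hZle
  have hH0 : (0 : ℝ) < H := by exact_mod_cast hH1
  have hZ0 : (0 : ℝ) < Z := by exact_mod_cast hZ1
  have hMH : (M : ℝ) ^ (1 - γ) ≤ H :=
    (Real.rpow_le_rpow_of_exponent_le hM1 (by linarith)).trans hHle
  have hD : 2 * Real.pi * (H * (M : ℝ) ^ (γ - 2) * Z) + (2 * (H * (M : ℝ) ^ (γ - 2)) + 2 / M)
      ≤ 100 / Z := by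
    rw [le_div_iff₀ hZ0]
    have h1 : H * (M : ℝ) ^ (γ - 2) * (Z * Z) ≤ 8 := by
      calc H * (M : ℝ) ^ (γ - 2) * (Z * Z)
          ≤ (2 * (M : ℝ) ^ σ) * (M : ℝ) ^ (γ - 2) * ((2 * (M : ℝ) ^ τ) * (2 * (M : ℝ) ^ τ)) := by
            gcongr
        _ = 8 * ((M : ℝ) ^ σ * (M : ℝ) ^ (γ - 2) * ((M : ℝ) ^ τ * (M : ℝ) ^ τ)) := by ring
        _ = 8 := by
            rw [← Real.rpow_add hM0, ← Real.rpow_add hM0, ← Real.rpow_add hM0,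
              show σ + (γ - 2) + (τ + τ) = 0 by rw [hσ, hτ]; ring, Real.rpow_zero, mul_one]
    have h2 : H * (M : ℝ) ^ (γ - 2) * Z ≤ H * (M : ℝ) ^ (γ - 2) * (Z * Z) := by
      have : (1 : ℝ) ≤ Z := by exact_mod_cast hZ1
      gcongr
      nlinarith
    have h3 : (Z : ℝ) / M ≤ 2 := by
      rw [div_le_iff₀ hM0]
      refine hZ2.trans ?_
      have : (M : ℝ) ^ τ ≤ (M : ℝ) ^ (1 : ℝ) :=
        Real.rpow_le_rpow_of_exponent_le hM1 (by linarith)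
      rw [Real.rpow_one] at this
      linarith
    calc _ = 2 * Real.pi * (H * (M : ℝ) ^ (γ - 2) * (Z * Z)) + 2 * (H * (M : ℝ) ^ (γ - 2) * Z)
          + 2 * (Z / M) := by ring
      _ ≤ 2 * Real.pi * 8 + 2 * 8 + 2 * 2 := by
          have := Real.pi_pos
          gcongr
          exact h2.trans h1
      _ ≤ 100 := by linarith [Real.pi_lt_d2]
  set Y := 101 * C' * (M : ℝ) ^ (-((1 - a) * τ)) with hY
  have hmean : ∀ g : ℕ → ℂ, (∀ n, ‖g n‖ ≤ 1) →
      (∀ j : ℕ, 1 ≤ j → ∫ θ in (0 : ℝ)..1, supShortExpSum g j θ ≤ C' * (j : ℝ) ^ a) →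
      (∫ θ in (0 : ℝ)..1, blockMajorant g 100 Z θ) / Z ≤ Y := by
    intro g hg hgI
    have h1 := integral_blockMajorant_le hg ha0 hC'0 (by norm_num : (0 : ℝ) ≤ 100) hgI hZ1
    have h2 : (Z : ℝ) ^ a / Z = (Z : ℝ) ^ (a - 1) := (Real.rpow_sub_one hZ0.ne' a).symm
    have h3 : (Z : ℝ) ^ (a - 1) ≤ ((M : ℝ) ^ τ) ^ (a - 1) :=
      Real.rpow_le_rpow_of_nonpos (by linarith) hZle (by linarith)
    have h4 : ((M : ℝ) ^ τ) ^ (a - 1) = (M : ℝ) ^ (-((1 - a) * τ)) := by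
      rw [← Real.rpow_mul hM0.le]
      congr 1
      ring
    calc _ ≤ (C' * (1 + 100) * (Z : ℝ) ^ a) / Z := by gcongr
      _ = 101 * C' * ((Z : ℝ) ^ a / Z) := by ring
      _ ≤ _ := by
        rw [h2, hY, ← h4]
        gcongr
  have hYf := hmean f hf fun j hj => (hI j hj).trans (by gcongr; exact le_max_left _ _)
  have hY1 := hmean (fun _ => 1) (by simp) fun j _ =>
    (integral_supShortExpSum_one_le ⟨ha0, ha1⟩ j).trans (by gcongr; exact le_max_right _ _)
  have hMY : M * Y ≤ 101 * C' * (M : ℝ) ^ (γ - s) := by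
    calc M * Y = 101 * C' * ((M : ℝ) ^ (1 : ℝ) * (M : ℝ) ^ (-((1 - a) * τ))) := by
          rw [hY, Real.rpow_one]
          ring
      _ ≤ _ := by
          rw [← Real.rpow_add hM0]
          gcongr
          linarith
  have hZγ : (Z : ℝ) ≤ 2 * (M : ℝ) ^ (γ - s) := by
    refine hZ2.trans ?_
    gcongr
    nlinarith
  have hMHγ : (M : ℝ) / H ≤ (M : ℝ) ^ (γ - s) := by
    rw [div_le_iff₀ hH0]
    calc (M : ℝ) = (M : ℝ) ^ (γ - s) * (M : ℝ) ^ σ := by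
          rw [← Real.rpow_add hM0, hσ]
          norm_num
      _ ≤ _ := by gcongr
  have hlog0 : 0 ≤ Real.log H := Real.log_nonneg (by exact_mod_cast hH1)
  have hlog : 1 + Real.log H ≤ 2 + Real.log M := by
    have h1 : (H : ℝ) ≤ 2 * M := by
      have : (M : ℝ) ^ σ ≤ (M : ℝ) ^ (1 : ℝ) :=
        Real.rpow_le_rpow_of_exponent_le hM1 (by linarith)
      rw [Real.rpow_one] at this
      linarith
    have h2 := Real.log_le_log hH0 h1
    rw [Real.log_mul (by norm_num) hM0.ne'] at h2
    linarith [Real.log_two_lt_d9]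
  refine (norm_sum_sawtooth_diff_le hf ⟨hγ0, hγ1⟩ hM hMM (by omega) hZ1 hH1 hMH (by norm_num) hD
    hYf hY1).trans ?_
  calc 165 * (1 + Real.log H) ^ 2 * (κ * M * Y + Z + M / H)
      ≤ 165 * ((2 + 2 / ε) ^ 2 * (M : ℝ) ^ ε)
        * (κ * (101 * C' * (M : ℝ) ^ (γ - s)) + 2 * (M : ℝ) ^ (γ - s) + (M : ℝ) ^ (γ - s)) := by
        rw [mul_assoc κ]
        have h1 : (1 + Real.log H) ^ 2 ≤ (2 + 2 / ε) ^ 2 * (M : ℝ) ^ ε :=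
          le_trans (by gcongr) (two_add_log_sq_le hε0 hM1)
        have h2 : 0 ≤ M * Y := by positivity
        gcongr
    _ = 165 * (2 + 2 / ε) ^ 2 * (κ * (101 * C') + 3) * ((M : ℝ) ^ ε * (M : ℝ) ^ (γ - s)) := by ring
    _ = _ := by
        rw [← Real.rpow_add hM0]
        congr 2
        rw [hε]
        ring

/-- Halving the range repeatedly sums the dyadic bounds to a geometric series. -/
lemma norm_sum_Ioc_zero_le_of_dyadic {F : ℕ → ℂ} {B ρ : ℝ} (hB : 0 ≤ B) (hρ : 0 < ρ)
    (hF1 : ‖F 1‖ ≤ 1)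
    (hF : ∀ M M' : ℕ, 1 ≤ M → M ≤ M' → M' ≤ 2 * M + 1 →
      ‖∑ m ∈ Finset.Ioc M M', F m‖ ≤ B * (M : ℝ) ^ ρ) (X : ℕ) :
    ‖∑ m ∈ Finset.Ioc 0 X, F m‖ ≤ (1 + B / (1 - 2 ^ (-ρ))) * (X : ℝ) ^ ρ := by
  have h2 : (2 : ℝ) ^ (-ρ) < 1 := Real.rpow_lt_one_of_one_lt_of_neg (by norm_num) (by linarith)
  have h20 : (0 : ℝ) < 2 ^ (-ρ) := by positivity
  have hd : 0 < 1 - (2 : ℝ) ^ (-ρ) := by linarith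
  set K := 1 + B / (1 - 2 ^ (-ρ)) with hK
  have hK1 : 1 ≤ K := by
    have : 0 ≤ B / (1 - 2 ^ (-ρ)) := by positivity
    linarith
  have hKB : K * 2 ^ (-ρ) + B ≤ K := by
    have : B / (1 - 2 ^ (-ρ)) * (1 - 2 ^ (-ρ)) = B := div_mul_cancel₀ B hd.ne'
    rw [hK]
    nlinarith
  induction X using Nat.strong_induction_on with
  | _ X ih =>
    rcases Nat.lt_or_ge X 2 with hX | hX
    · interval_cases X
      · simp [Real.zero_rpow hρ.ne']
      · simpa using hF1.trans hK1
    · have hX0 : (0 : ℝ) ≤ X := X.cast_nonneg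
      set M := X / 2 with hM
      have hMle : (M : ℝ) ≤ 2⁻¹ * X := by
        have : 2 * M ≤ X := by omega
        have : (2 : ℝ) * M ≤ X := by exact_mod_cast this
        linarith
      have hMρ : (M : ℝ) ^ ρ ≤ 2 ^ (-ρ) * (X : ℝ) ^ ρ := by
        refine (Real.rpow_le_rpow M.cast_nonneg hMle hρ.le).trans (le_of_eq ?_)
        rw [Real.mul_rpow (by norm_num) hX0, Real.inv_rpow (by norm_num), ← Real.rpow_neg (by norm_num)]
      have hMρ' : (M : ℝ) ^ ρ ≤ (X : ℝ) ^ ρ := by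
        refine Real.rpow_le_rpow M.cast_nonneg (hMle.trans ?_) hρ.le
        linarith
      rw [← Finset.sum_Ioc_consecutive F M.zero_le (by omega : M ≤ X)]
      refine (norm_add_le _ _).trans ?_
      calc _ ≤ K * (M : ℝ) ^ ρ + B * (M : ℝ) ^ ρ :=
            add_le_add (ih M (by omega)) (hF M X (by omega) (by omega) (by omega))
        _ ≤ K * (2 ^ (-ρ) * (X : ℝ) ^ ρ) + B * (X : ℝ) ^ ρ := by gcongr
        _ = (K * 2 ^ (-ρ) + B) * (X : ℝ) ^ ρ := by ring
        _ ≤ _ := by gcongr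

/-! ### Counting Piatetski-Shapiro numbers -/

/-- The numbers `n` with `⌊n ^ c⌋ = m` are those with `⌈m ^ (1 / c)⌉ ≤ n < ⌈(m + 1) ^ (1 / c)⌉`. -/
lemma sum_Ico_natFloor_rpow_eq {c : ℝ} (hc : 0 < c) (φ : ℕ → ℂ) (K : ℕ) :
    ∑ n ∈ Finset.Ico 1 ⌈((K : ℝ) + 1) ^ c⁻¹⌉₊, φ ⌊(n : ℝ) ^ c⌋₊
      = ∑ m ∈ Finset.Ioc 0 K, φ m *
        (((⌈((m : ℝ) + 1) ^ c⁻¹⌉₊ : ℝ) - (⌈(m : ℝ) ^ c⁻¹⌉₊ : ℝ) : ℝ) : ℂ) := by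
  have hci : 0 < c⁻¹ := inv_pos.2 hc
  induction K with
  | zero => simp
  | succ K ih =>
    set A := ⌈((K : ℝ) + 1) ^ c⁻¹⌉₊ with hA
    set A' := ⌈(((K + 1 : ℕ) : ℝ) + 1) ^ c⁻¹⌉₊ with hA'
    have h1A : 1 ≤ A := Nat.one_le_ceil_iff.2 (by positivity)
    have hAA' : A ≤ A' := Nat.ceil_mono (Real.rpow_le_rpow (by positivity)
      (by push_cast; linarith) hci.le)
    rw [← Finset.sum_Ico_consecutive _ h1A hAA', ih, Finset.sum_Ioc_succ_top (by omega)]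
    congr 1
    have hfib : ∀ n ∈ Finset.Ico A A', φ ⌊(n : ℝ) ^ c⌋₊ = φ (K + 1) := by
      intro n hn
      rw [Finset.mem_Ico, hA, hA', Nat.ceil_le, Nat.lt_ceil,
        Real.rpow_inv_le_iff_of_pos (by positivity) (by positivity) hc,
        Real.lt_rpow_inv_iff_of_pos (by positivity) (by positivity) hc] at hn
      congr 1
      rw [Nat.floor_eq_iff (by positivity)]
      push_cast at hn ⊢
      exact hn
    rw [Finset.sum_congr rfl hfib, Finset.sum_const, Nat.card_Ico, nsmul_eq_mul, mul_comm,
      Nat.cast_sub hAA', ← hA']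
    push_cast
    rfl

/-- At most one `n > N` satisfies `⌊n ^ c⌋ ≤ ⌊N ^ c⌋`, since consecutive values of `n ^ c` differ by at
least `1`. -/
lemma norm_sum_Icc_sub_sum_Ico_le_one {c N : ℝ} (hc : 1 ≤ c) (hN : 0 ≤ N) {u : ℕ → ℂ}
    (hu : ∀ n, ‖u n‖ ≤ 1) :
    ‖∑ n ∈ Finset.Icc 1 ⌊N⌋₊, u n
      - ∑ n ∈ Finset.Ico 1 ⌈((⌊N ^ c⌋₊ : ℝ) + 1) ^ c⁻¹⌉₊, u n‖ ≤ 1 := by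
  have hc0 : 0 < c := by linarith
  set A := ⌈((⌊N ^ c⌋₊ : ℝ) + 1) ^ c⁻¹⌉₊ with hA
  have hNc : 0 ≤ N ^ c := Real.rpow_nonneg hN c
  have h1 : ⌊N⌋₊ + 1 ≤ A := by
    rw [Nat.add_one_le_iff, hA, Nat.lt_ceil]
    refine (Nat.floor_le hN).trans_lt ?_
    rw [Real.lt_rpow_inv_iff_of_pos hN (by positivity) hc0]
    exact Nat.lt_floor_add_one _
  have h2 : A ≤ ⌊N⌋₊ + 1 + 1 := by
    rw [hA, Nat.ceil_le, Real.rpow_inv_le_iff_of_pos (by positivity) (by positivity) hc0]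
    have h3 : N ^ c ≤ ((⌊N⌋₊ + 1 : ℕ) : ℝ) ^ c :=
      Real.rpow_le_rpow hN (by push_cast; exact (Nat.lt_floor_add_one N).le) hc0.le
    have h4 := Real.add_rpow_le_rpow_add (a := ((⌊N⌋₊ + 1 : ℕ) : ℝ)) (b := 1) (by positivity)
      (by norm_num) hc
    rw [Real.one_rpow] at h4
    have h5 := Nat.floor_le hNc
    rw [Nat.cast_add_one (⌊N⌋₊ + 1)]
    linarith
  have h3 : Finset.Icc 1 ⌊N⌋₊ = Finset.Ico 1 (⌊N⌋₊ + 1) := by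
    ext n
    simp only [Finset.mem_Icc, Finset.mem_Ico]
    omega
  rw [h3, ← Finset.sum_Ico_consecutive u (by omega : 1 ≤ ⌊N⌋₊ + 1) h1, sub_add_cancel_left, norm_neg]
  refine (norm_sum_le_of_le _ fun n _ => hu n).trans ?_
  rw [Finset.sum_const, Nat.card_Ico, nsmul_eq_mul, mul_one]
  exact_mod_cast (by omega : A - (⌊N⌋₊ + 1) ≤ 1)

/-- By monotonicity of the derivative the differences are dominated by a telescoping sum. -/
lemma norm_sum_rpow_diff_sub_le_one {γ : ℝ} (hγ : γ ∈ Set.Ioo (0 : ℝ) 1) {f : ℕ → ℂ}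
    (hf : ∀ n, ‖f n‖ ≤ 1) (K : ℕ) :
    ‖∑ m ∈ Finset.Ioc 0 K, f m *
      ((((m : ℝ) + 1) ^ γ - (m : ℝ) ^ γ - γ * (m : ℝ) ^ (γ - 1) : ℝ) : ℂ)‖ ≤ 1 := by
  have hterm : ∀ m ∈ Finset.Ioc 0 K,
      ‖f m * ((((m : ℝ) + 1) ^ γ - (m : ℝ) ^ γ - γ * (m : ℝ) ^ (γ - 1) : ℝ) : ℂ)‖
        ≤ γ * (m : ℝ) ^ (γ - 1) - γ * ((m : ℝ) + 1) ^ (γ - 1) := by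
    intro m hm
    have hm0 : (0 : ℝ) < m := by exact_mod_cast (Finset.mem_Ioc.1 hm).1
    obtain ⟨ξ, hξ, hξe⟩ := exists_add_one_rpow_sub_rpow_eq (γ := γ) hm0
    rw [norm_mul, Complex.norm_real, Real.norm_eq_abs, hξe]
    refine (mul_le_of_le_one_left (abs_nonneg _) (hf m)).trans ?_
    have h1 : ξ ^ (γ - 1) ≤ (m : ℝ) ^ (γ - 1) :=
      Real.rpow_le_rpow_of_nonpos hm0 hξ.1.le (by linarith [hγ.2])
    have h2 : ((m : ℝ) + 1) ^ (γ - 1) ≤ ξ ^ (γ - 1) :=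
      Real.rpow_le_rpow_of_nonpos (hm0.trans hξ.1) hξ.2.le (by linarith [hγ.2])
    have h1' := mul_le_mul_of_nonneg_left h1 hγ.1.le
    have h2' := mul_le_mul_of_nonneg_left h2 hγ.1.le
    rw [abs_of_nonpos (by linarith)]
    linarith
  refine (norm_sum_le_of_le _ hterm).trans ?_
  have htel : ∑ m ∈ Finset.Ioc 0 K, (γ * (m : ℝ) ^ (γ - 1) - γ * ((m : ℝ) + 1) ^ (γ - 1))
      = γ - γ * ((K : ℝ) + 1) ^ (γ - 1) := by
    induction K with
    | zero => simp
    | succ K ih =>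
      rw [Finset.sum_Ioc_succ_top (by omega), ih fun m hm => hterm m ?_]
      · push_cast
        ring
      · rw [Finset.mem_Ioc] at hm ⊢
        omega
  rw [htel]
  have : 0 ≤ γ * ((K : ℝ) + 1) ^ (γ - 1) := mul_nonneg hγ.1.le (by positivity)
  linarith [hγ.2]

/-! ### The theorem -/

theorem mainTheorem3 (a C c η : ℝ) (ha : a ∈ Set.Ioc (0 : ℝ) 1) (hc : c ∈ Set.Ioo (1 : ℝ) 2)
    (hη : η ∈ Set.Ioo (0 : ℝ) ((2 - (a + 1) * c) / (3 - a))) :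
    ∃ C₁ : ℝ, ∀ φ : ℕ → ℂ, (∀ n, ‖φ n‖ ≤ 1) →
      (∀ z : ℝ, 1 ≤ z → (∫ θ in (0 : ℝ)..1, ⨆ x : ℝ≥0, ‖shortExpSum φ z θ x‖) ≤ C * z ^ a) →
      ∀ N : ℝ, 1 ≤ N →
        1 / N * ‖∑ n ∈ Finset.Icc 1 ⌊N⌋₊, φ ⌊(n : ℝ) ^ c⌋₊
          - 1 / (c : ℂ) * ∑ m ∈ Finset.Icc 1 ⌊N ^ c⌋₊, φ m * (((m : ℝ) ^ (1 / c - 1) : ℝ) : ℂ)‖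
        ≤ C₁ * N ^ (-η) := by
  obtain ⟨ha0, ha1⟩ := ha
  obtain ⟨hc1, hc2⟩ := hc
  obtain ⟨hη0, hη1⟩ := hη
  have hc0 : 0 < c := by linarith
  -- The room between `η` and the bound for it pays for the logarithms.
  obtain ⟨η', hηη', hη'⟩ := exists_between hη1
  rw [lt_div_iff₀ (by linarith)] at hη'
  have hη'1 : η' < 1 := by nlinarith
  set γ := c⁻¹ with hγdef
  have hcγ : c * γ = 1 := mul_inv_cancel₀ hc0.ne'
  have hγ0 : 0 < γ := inv_pos.2 hc0
  have hγ : γ ∈ Set.Ioo (0 : ℝ) 1 := ⟨hγ0, inv_lt_one_of_one_lt₀ hc1⟩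
  set ρ := γ * (1 - η) with hρ
  have hρ0 : 0 < ρ := mul_pos hγ0 (by linarith)
  have hs : γ * η' ∈ Set.Ioo 0 γ :=
    ⟨mul_pos hγ0 (by linarith), mul_lt_of_lt_one_right hγ0 hη'1⟩
  have has : 1 - (1 - a) * ((1 - γ * η') / 2) ≤ γ - γ * η' := by
    have h1 : γ * (η' * (3 - a)) ≤ γ * (2 - (a + 1) * c) := by gcongr
    linear_combination (1 / 2) * h1 - ((1 + a) / 2) * hcγ
  obtain ⟨B, hB, hdy⟩ := exists_dyadic_sawtooth_bound (ρ := ρ) ⟨ha0, ha1⟩ (le_max_right C 0) hγ hs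
    has (by rw [hρ]; nlinarith)
  set K₀ := 1 + B / (1 - 2 ^ (-ρ)) with hK₀
  refine ⟨2 + K₀, fun φ hφ hI N hN => ?_⟩
  have hN0 : 0 < N := by linarith
  -- `max C 0` replaces `C`: the hypothesis may be given with a negative `C`.
  have hI' : ∀ j : ℕ, 1 ≤ j →
      ∫ θ in (0 : ℝ)..1, supShortExpSum φ j θ ≤ max C 0 * (j : ℝ) ^ a := fun j hj =>
    (hI j (by exact_mod_cast hj)).trans
      (mul_le_mul_of_nonneg_right (le_max_left _ _) (by positivity))
  set K := ⌊N ^ c⌋₊ with hK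
  have hsaw := norm_sum_Ioc_zero_le_of_dyadic hB hρ0 ?_ (hdy φ hφ hI') K
  swap
  · rw [norm_mul, Complex.norm_real, Real.norm_eq_abs]
    refine (mul_le_of_le_one_left (abs_nonneg _) (hφ 1)).trans ?_
    have h1 := fun y : ℝ => Int.le_ceil y
    have h2 := fun y : ℝ => Int.ceil_lt_add_one y
    rw [abs_le]
    constructor <;> linarith [h1 (((1 : ℕ) : ℝ) ^ γ), h2 (((1 : ℕ) : ℝ) ^ γ),
      h1 ((((1 : ℕ) : ℝ) + 1) ^ γ), h2 ((((1 : ℕ) : ℝ) + 1) ^ γ)]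
  have hends := norm_sum_Icc_sub_sum_Ico_le_one hc1.le hN0.le
    (u := fun n => φ ⌊(n : ℝ) ^ c⌋₊) fun n => hφ _
  rw [sum_Ico_natFloor_rpow_eq hc0] at hends
  have htel := norm_sum_rpow_diff_sub_le_one hγ hφ K
  have hsplit : ∑ m ∈ Finset.Ioc 0 K, φ m *
        (((⌈((m : ℝ) + 1) ^ γ⌉₊ : ℝ) - (⌈(m : ℝ) ^ γ⌉₊ : ℝ) : ℝ) : ℂ)
      - 1 / (c : ℂ) * ∑ m ∈ Finset.Icc 1 K, φ m * (((m : ℝ) ^ (1 / c - 1) : ℝ) : ℂ)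
      = ∑ m ∈ Finset.Ioc 0 K, φ m *
          ((((m : ℝ) + 1) ^ γ - (m : ℝ) ^ γ - γ * (m : ℝ) ^ (γ - 1) : ℝ) : ℂ)
        + ∑ m ∈ Finset.Ioc 0 K, φ m *
          (((⌈((m : ℝ) + 1) ^ γ⌉ - ((m : ℝ) + 1) ^ γ) - (⌈(m : ℝ) ^ γ⌉ - (m : ℝ) ^ γ) : ℝ) : ℂ) := by
    have hIcc : Finset.Icc 1 K = Finset.Ioc 0 K := rfl
    rw [hIcc, Finset.mul_sum, ← Finset.sum_sub_distrib, ← Finset.sum_add_distrib]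
    refine Finset.sum_congr rfl fun m _ => ?_
    rw [natCast_ceil_eq_intCast_ceil (by positivity), natCast_ceil_eq_intCast_ceil (by positivity),
      one_div, one_div, ← hγdef, ← Complex.ofReal_inv, ← hγdef]
    push_cast
    ring
  have hKN : (K : ℝ) ^ ρ ≤ N ^ (1 - η) := by
    have h1 : (K : ℝ) ≤ N ^ c := Nat.floor_le (by positivity)
    refine (Real.rpow_le_rpow K.cast_nonneg h1 hρ0.le).trans (le_of_eq ?_)
    rw [← Real.rpow_mul hN0.le, hρ, ← mul_assoc, hcγ, one_mul]
  have hN1 : 1 ≤ N ^ (1 - η) := Real.one_le_rpow hN (by linarith)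
  have hK₀0 : 0 ≤ K₀ := by
    have : (2 : ℝ) ^ (-ρ) < 1 := Real.rpow_lt_one_of_one_lt_of_neg (by norm_num) (by linarith)
    have : 0 < 1 - (2 : ℝ) ^ (-ρ) := by linarith
    positivity
  have hNη : N ^ (-η) = 1 / N * N ^ (1 - η) := by
    rw [sub_eq_neg_add, Real.rpow_add_one hN0.ne']
    field_simp
  rw [hNη, mul_left_comm]
  refine mul_le_mul_of_nonneg_left ?_ (by positivity)
  -- Three pieces: the end of the range of `n`, the smooth weight, and the sawtooth sum.
  rw [← sub_add_sub_cancel _ (∑ m ∈ Finset.Ioc 0 K, φ m *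
        (((⌈((m : ℝ) + 1) ^ γ⌉₊ : ℝ) - (⌈(m : ℝ) ^ γ⌉₊ : ℝ) : ℝ) : ℂ)), hsplit]
  refine (norm_add_le _ _).trans ((add_le_add hends ((norm_add_le _ _).trans
    (add_le_add htel hsaw))).trans ?_)
  have := mul_le_mul_of_nonneg_left hKN hK₀0
  linarith
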